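/- **Setting.** Let $\alpha,\beta\in\mathbb R\setminus\{0\}$ (the coupled dispersive AB system is $A_{xt}-\alpha A-\beta AB=0$, $B_x+\frac{\gamma}{2}(|A|^2)_t=0$ with $\beta\gamma=1$). Let $k_1,\dots,k_N\in\mathbb C^+$ be distinct, $\mathcal K=\{k_j\}$, $c_1,\dots,c_N\in\mathbb C\setminus\{0\}$, and let $r\in L^2(\mathbb R)$ be the reflection coefficient. Let $x_1<x_2$ and $v_1<v_2$ with $\alpha v_1<0$, $\alpha v_2<0$, and $$\mathcal C=\{(x,t): x=x_0+vt,\ x_0\in[x_1,x_2],\ v\in[v_1,v_2]\},\qquad f(v)=\Big(-\frac{\alpha}{4v}\Big)^{1/2},$$ $$\mathcal I=\{k: |k| \text{ strictly between } f(v_1)\text{ and }f(v_2)\},\qquad \mathcal K(\mathcal I)=\mathcal K\cap\mathcal I .$$ Put $v_{k_j}=-\alpha/(4|k_j|^2)$ and $\mu=\min_{k_j\in\mathcal K\setminus\mathcal K(\mathcal I)}\operatorname{Im}k_j\,\operatorname{dist}(v_{k_j},[v_1,v_2])$ ($\mu$ is an arbitrary real number if $\mathcal K\setminus\mathcal K(\mathcal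 I)=\emptyset$). **Discrete Riemann–Hilbert problem.** Let $t\theta(k)=kx-\frac{\alpha t}{4k}$. For an index set $S\subseteq\{1,\dots,N\}$, a set $\nabla\subseteq S$ and constants $(\kappa_j)_{j\in S}$, the matrix $M(x,t,k)$ is the solution of: $M$ is analytic in $k$ off $\{k_j,k_j^*\}_{j\in S}$; $M(k)=\sigma_0M^*(k^*)\sigma_0^{-1}$ with $\sigma_0=\begin{pmatrix}0&1\\-1&0\end{pmatrix}$; $M=I+\mathcal O(k^{-1})$ as $k\to\infty$; and at $k_j,k_j^*$ ($j\in S$) $M$ has at most simple poles, with $\operatorname{Res}_{k_j}M=\lim_{k\to k_j}M\Theta_j$ and $\operatorname{Res}_{k_j^*}M=\lim_{k\to k_j^*}M\Theta_j'$, where, if $j\in\nabla$, $$\Theta_j=\begin{pmatrix}0&\kappa_je^{-2it\theta(k_j)}\\0&0\end{pmatrix},\quad \Theta_j'=\begin{pmatrix}0&0\\-\kappa_j^*e^{2it\theta(k_j^*)}&0\end{pmatrix},$$ and, if $j\notin\nabla$, $$\Theta_j=\begin{pmatrix}0&0\\\kappa_je^{2it\theta(k_j)}&0\end{pmatrix},\quad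 \Theta_j'=\begin{pmatrix}0&-\kappa_j^*e^{-2it\theta(k_j^*)}\\0&0\end{pmatrix}.$$ The soliton solution with these data is $A_{sol}=4i\lim_{k\to\infty}[kM]_{12}$, $B_{sol}=-\frac{4i}{\beta}\lim_{k\to\infty}\frac{d}{dt}[kM]_{11}$, where the data $S,\nabla,(\kappa_j)$ are held fixed in $\frac{d}{dt}$. **Data.** For $(x,t)\in\mathcal C$ with $t$ large let $k_0=\sqrt{-\alpha t/(4x)}$, $\Delta^{-}_{k_0}=\{j:|k_j|<k_0\}$, $\Delta^+_{k_0}=\{j:|k_j|>k_0\}$, $s_{11,\nabla}(k)=\prod_{j\in\nabla}\frac{k-k_j}{k-k_j^*}$, and $$\delta(k)=\exp\Big[i\int_{I}\frac{\nu(s)}{s-k}\,ds\Big],\qquad \nu=-\tfrac1{2\pi}\log(1+|r|^2),$$ where $I=(-k_0,k_0)$, $\Delta=\Delta^-_{k_0}$ if $\alpha<0$, and $I=\{s\in\mathbb R:|s|>k_0\}$, $\Delta=\Delta^+_{k_0}$ if $\alpha>0$. For $\nabla\in\{\Delta^+_{k_0},\Delta^-_{k_0}\}$: * $\widetilde{\mathcal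 D}$ consists of $S=\{1,\dots,N\}$, $\nabla$, and $\kappa_j=c_j^{-1}s_{11,\nabla}'(k_j)^{-2}\delta(k_j)^2$ for $j\in\nabla$, $\kappa_j=c_js_{11,\nabla}(k_j)^2\delta(k_j)^{-2}$ for $j\notin\nabla$. * $\widetilde{\mathcal D}(\mathcal I)$ is built in the same way from $S=\{j:k_j\in\mathcal K(\mathcal I)\}$, the set $\nabla\cap S$ in place of $\nabla$, and, in place of $c_j$, $\;c_j(\mathcal I)=c_j\prod_{n\in\Delta,\ k_n\notin\mathcal I}\big(\frac{k_j-k_n}{k_j-k_n^*}\big)^2$. **Claim.** There are constants $C$ and $T>0$ such that for all $(x,t)\in\mathcal C$ with $t\ge T$ one has $-\alpha t/(4x)>0$, the Riemann–Hilbert problems with data $\widetilde{\mathcal D}$ and with data $\widetilde{\mathcal D}(\mathcal I)$ are uniquely solvable (for all real values of the space and time arguments), the limits and derivatives that define the soliton solutions at $(x,t)$ exist and do not depend on the choice of $\nabla\in\{\Delta^+_{k_0},\Delta^-_{k_0}\}$, and $$|A_{sol}(x,t|\widetilde{\mathcal D})-A_{sol}(x,t|\widetilde{\mathcal D}(\mathcal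 I))|\le Ce^{-2\mu t},\qquad |B_{sol}(x,t|\widetilde{\mathcal D})-B_{sol}(x,t|\widetilde{\mathcal D}(\mathcal I))|\le Ce^{-2\mu t}.$$ -/

import Mathlib

open Filter Topology MeasureTheory ComplexConjugate

noncomputable section

namespace ABSystem

variable {N : ℕ}

/-! Discrete (reflectionless) Riemann-Hilbert problems -/

/-- The phase `t θ(z) = z x - α t / (4 z)`. -/
def tTheta (α x t : ℝ) (z : ℂ) : ℂ := z * x - α * t / (4 * z)

/-- The Blaschke product `s_{11,∇}(z) = ∏_{j ∈ ∇} (z - k_j) / (z - k_j^*)`. -/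
def s11 (k : Fin N → ℂ) (nabla : Finset (Fin N)) (z : ℂ) : ℂ :=
  ∏ j ∈ nabla, (z - k j) / (z - conj (k j))

/-- Reflectionless scattering data: the eigenvalues `pole j` for `j ∈ index`, the constants
`coeff j` attached to them, and the set `nabla` of those `j` for which the second (instead of the
first) column of the solution is singular at `pole j`. -/
structure SolitonData (N : ℕ) where
  index : Finset (Fin N)
  pole : Fin N → ℂ
  coeff : Fin N → ℂ
  nabla : Finset (Fin N)

/-- The set of the eigenvalues and of their complex conjugates. -/
def SolitonData.poles (D : SolitonData N) : Set ℂ :=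
  {z | ∃ j ∈ D.index, z = D.pole j ∨ z = conj (D.pole j)}

/-- The nilpotent matrix in the residue condition at `k_j`. -/
def SolitonData.residueMatrix (D : SolitonData N) (α x t : ℝ) (j : Fin N) :
    Matrix (Fin 2) (Fin 2) ℂ :=
  if j ∈ D.nabla then
    !![0, D.coeff j * Complex.exp (-2 * Complex.I * tTheta α x t (D.pole j)); 0, 0]
  else
    !![0, 0; D.coeff j * Complex.exp (2 * Complex.I * tTheta α x t (D.pole j)), 0]

/-- The nilpotent matrix in the residue condition at `k_j^*`. -/
def SolitonData.residueMatrixConj (D : SolitonData N) (α x t : ℝ) (j : Fin N) :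
    Matrix (Fin 2) (Fin 2) ℂ :=
  if j ∈ D.nabla then
    !![0, 0;
      -conj (D.coeff j) * Complex.exp (2 * Complex.I * tTheta α x t (conj (D.pole j))), 0]
  else
    !![0, -conj (D.coeff j) * Complex.exp (-2 * Complex.I * tTheta α x t (conj (D.pole j)));
      0, 0]

/-- `M` has at most a simple pole at `p`, and `Res_{z = p} M = lim_{z → p} M(z) Θ`. -/
def HasResidueRelation (M : ℂ → Matrix (Fin 2) (Fin 2) ℂ) (p : ℂ)
    (Θ : Matrix (Fin 2) (Fin 2) ℂ) : Prop :=
  ∃ R : Matrix (Fin 2) (Fin 2) ℂ,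
    Tendsto (fun z => (z - p) • M z) (𝓝[≠] p) (𝓝 R) ∧
    Tendsto (fun z => M z * Θ) (𝓝[≠] p) (𝓝 R)

/-- The matrix `σ₀`. -/
def sigma0 : Matrix (Fin 2) (Fin 2) ℂ := !![0, 1; -1, 0]

/-- `M = M(x, t, ·)` solves the discrete Riemann-Hilbert problem with data `D` at `(x, t)`. -/
structure SolvesRHP (α : ℝ) (D : SolitonData N) (x t : ℝ)
    (M : ℂ → Matrix (Fin 2) (Fin 2) ℂ) : Prop where
  analytic : ∀ a b, DifferentiableOn ℂ (fun z => M z a b) D.polesᶜ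
  symmetry : ∀ z ∉ D.poles, M z = sigma0 * (M (conj z)).map conj * sigma0⁻¹
  asymptotics : ∀ a b, (fun z => M z a b - (1 : Matrix (Fin 2) (Fin 2) ℂ) a b)
    =O[Bornology.cobounded ℂ] fun z => z⁻¹
  residue : ∀ j ∈ D.index, HasResidueRelation M (D.pole j) (D.residueMatrix α x t j)
  residue_conj : ∀ j ∈ D.index,
    HasResidueRelation M (conj (D.pole j)) (D.residueMatrixConj α x t j)

/-- `A = 4 i lim_{z → ∞} [z M(x, t, z)]₁₂`. -/
def RecoversA (M : ℝ → ℝ → ℂ → Matrix (Fin 2) (Fin 2) ℂ) (x t : ℝ) (A : ℂ) : Prop :=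
  Tendsto (fun z => 4 * Complex.I * (z * M x t z 0 1)) (Bornology.cobounded ℂ) (𝓝 A)

/-- `B = -(4 i / β) lim_{z → ∞} d/dt [z M(x, t, z)]₁₁`, where the derivatives exist. -/
def RecoversB (β : ℝ) (M : ℝ → ℝ → ℂ → Matrix (Fin 2) (Fin 2) ℂ) (x t : ℝ) (B : ℂ) : Prop :=
  (∀ᶠ z in Bornology.cobounded ℂ, DifferentiableAt ℝ (fun τ : ℝ => z * M x τ z 0 0) t) ∧
  Tendsto (fun z => -(4 * Complex.I / β) * deriv (fun τ : ℝ => z * M x τ z 0 0) t)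
    (Bornology.cobounded ℂ) (𝓝 B)

/-- `A` and `B` are the values `A_sol(x, t | D)` and `B_sol(x, t | D)` at the point `(x, t)` of the
soliton solution with the (fixed) data `D`: the discrete Riemann-Hilbert problem is uniquely
solvable for all real arguments (its solution is determined off the poles), and `A` and `B` are
recovered from its solution. -/
structure IsSolitonValue (α β : ℝ) (D : SolitonData N) (x t : ℝ) (A B : ℂ) : Prop where
  exists_solution : ∃ M : ℝ → ℝ → ℂ → Matrix (Fin 2) (Fin 2) ℂ,
    ∀ y τ, SolvesRHP α D y τ (M y τ)
  unique_solution : ∀ (y τ : ℝ) (M M' : ℂ → Matrix (Fin 2) (Fin 2) ℂ),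
    SolvesRHP α D y τ M → SolvesRHP α D y τ M' → ∀ z ∉ D.poles, M z = M' z
  recovers : ∀ M : ℝ → ℝ → ℂ → Matrix (Fin 2) (Fin 2) ℂ,
    (∀ y τ, SolvesRHP α D y τ (M y τ)) → RecoversA M x t A ∧ RecoversB β M x t B

/-! Stationary points and the function `δ` -/

/-- The stationary phase point `k₀ = √(-α t / (4 x))`. -/
def k0 (α x t : ℝ) : ℝ := √(-(α * t) / (4 * x))

/-- `Δ⁻ = {j : |k_j| < κ}`. -/
def deltaMinus (k : Fin N → ℂ) (κ : ℝ) : Finset (Fin N) := {j | ‖k j‖ < κ}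

/-- `Δ⁺ = {j : |k_j| > κ}`. -/
def deltaPlus (k : Fin N → ℂ) (κ : ℝ) : Finset (Fin N) := {j | κ < ‖k j‖}

/-- The indices of the solitons that are faster than `x / t`, when `κ = k₀(x, t)`:
`Δ⁻` if `α < 0`, and `Δ⁺` if `α > 0`. -/
def fastSet (α : ℝ) (k : Fin N → ℂ) (κ : ℝ) : Finset (Fin N) :=
  if α < 0 then deltaMinus k κ else deltaPlus k κ

/-- The part of the real axis on which `δ` jumps: `(-κ, κ)` if `α < 0`, and `{s : |s| > κ}` if
`α > 0`. -/
def jumpSet (α κ : ℝ) : Set ℝ := if α < 0 then {s | |s| < κ} else {s | κ < |s|}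

/-- `ν(s) = -(1 / 2π) log (1 + |r(s)|²)`. -/
def nu (r : ℝ → ℂ) (s : ℝ) : ℝ := -(1 / (2 * Real.pi)) * Real.log (1 + ‖r s‖ ^ 2)

/-- `δ(z) = exp (i ∫ ν(s) / (s - z) ds)`, the integral taken over `jumpSet α κ`. -/
def delta (α : ℝ) (r : ℝ → ℂ) (κ : ℝ) (z : ℂ) : ℂ :=
  Complex.exp (Complex.I * ∫ s in jumpSet α κ, (nu r s : ℂ) / ((s : ℂ) - z))

/-! The cone and the eigenvalues inside it -/

/-- The cone `C(x₁, x₂, v₁, v₂)`. -/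
def cone (x₁ x₂ v₁ v₂ : ℝ) : Set (ℝ × ℝ) :=
  {p | ∃ x₀ ∈ Set.Icc x₁ x₂, ∃ v ∈ Set.Icc v₁ v₂, p.1 = x₀ + v * p.2}

/-- `f(v) = (-α / (4 v))^{1/2}`. -/
def fSpeed (α v : ℝ) : ℝ := √(-α / (4 * v))

/-- The region `𝓘` of all `z` with `|z|` strictly between `f(v₁)` and `f(v₂)`. -/
def annulus (α v₁ v₂ : ℝ) : Set ℂ :=
  {z | min (fSpeed α v₁) (fSpeed α v₂) < ‖z‖ ∧ ‖z‖ < max (fSpeed α v₁) (fSpeed α v₂)}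

open Classical in
/-- The indices of the eigenvalues in `𝓚(𝓘)`. -/
def inside (α v₁ v₂ : ℝ) (k : Fin N → ℂ) : Finset (Fin N) := {j | k j ∈ annulus α v₁ v₂}

/-- The velocity `-α / (4 |z|²)` of the soliton with eigenvalue `z`. -/
def velocity (α : ℝ) (z : ℂ) : ℝ := -α / (4 * ‖z‖ ^ 2)

/-- The numbers `Im k_j · dist(v_{k_j}, [v₁, v₂])` for the eigenvalues outside `𝓘`. -/
def rateSet (α v₁ v₂ : ℝ) (k : Fin N → ℂ) : Set ℝ :=
  {ρ | ∃ j, k j ∉ annulus α v₁ v₂ ∧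
    ρ = (k j).im * Metric.infDist (velocity α (k j)) (Set.Icc v₁ v₂)}

/-! The data `𝓓~` and `𝓓~(𝓘)` -/

/-- The data on the eigenvalues with indices in `S` that are obtained from the norming constants
`c_j`, the numbers `d_j = δ(k_j)` and the set `∇`. -/
def modulatedData (k c d : Fin N → ℂ) (S nabla : Finset (Fin N)) : SolitonData N where
  index := S
  pole := k
  coeff j :=
    if j ∈ nabla then (c j)⁻¹ * (deriv (s11 k nabla) (k j) ^ 2)⁻¹ * d j ^ 2
    else c j * s11 k nabla (k j) ^ 2 * (d j ^ 2)⁻¹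
  nabla := nabla

/-- The data `𝓓~` of the full problem (all eigenvalues), where `κ = k₀` and `∇ = Δ^±`. -/
def fullData (α : ℝ) (r : ℝ → ℂ) (k c : Fin N → ℂ) (κ : ℝ) (nabla : Finset (Fin N)) :
    SolitonData N :=
  modulatedData k c (fun j => delta α r κ (k j)) Finset.univ nabla

/-- `c_j ∏ ((k_j - k_n) / (k_j - k_n^*))²`, over the faster solitons `n` outside `𝓘`. -/
def insideConst (α v₁ v₂ : ℝ) (k c : Fin N → ℂ) (κ : ℝ) (j : Fin N) : ℂ :=
  c j * ∏ n ∈ fastSet α k κ \ inside α v₁ v₂ k, ((k j - k n) / (k j - conj (k n))) ^ 2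

/-- The data `𝓓~(𝓘)`: only the eigenvalues in `𝓚(𝓘)`, with the constants `insideConst`. -/
def insideData (α v₁ v₂ : ℝ) (r : ℝ → ℂ) (k c : Fin N → ℂ) (κ : ℝ) (nabla : Finset (Fin N)) :
    SolitonData N :=
  modulatedData k (insideConst α v₁ v₂ k c κ) (fun j => delta α r κ (k j))
    (inside α v₁ v₂ k) (nabla ∩ inside α v₁ v₂ k)

end ABSystem

end

noncomputable section

namespace ABSystem

variable {N : ℕ}

/-! Removable singularities and partial fractions -/

/-! The Riemann-Hilbert problem is reduced to linear algebra that does not see `∇`. Multiply each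
column of `M` by the Blaschke product of its poles in the upper half plane. The new rows have poles
only at the points `conj k_j`, with residue proportional to `conj χ_j`, and they annihilate `χ_j` at
`k_j`, where `χ_j ∈ ℂ²` is determined up to scaling. By Liouville the rows are sums of partial
fractions, and the kernel conditions become a linear system whose matrix is `G = (i (χ_n^† χ_j) /
(k_j - k_n^*))` (`SolvesWeakRHP.eq_dressed`, `dressed_solvesRHP`). A Cauchy matrix is positive
definite, so `G` is coercive with a constant depending on the eigenvalues only (`gram_coercive`).
This gives unique solvability and a uniform bound on the inverse for vectors of norm at least one
(`exists_gram_bound`).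

The ratio of the two entries of `χ_j` is `-C_j exp(2itθ(k_j))` times the derivative at `k_j` of the
Blaschke product over all eigenvalues. The choice of `∇` drops out (`represents_at_of_ratio`), so
`A` and `B` do not depend on it. Both are explicit in `χ` and in solutions of systems with matrix
`G`. For `B` this uses that the time derivative of `G` has rank one (`hasDerivAt_gram_evolve`).

In the cone, an eigenvalue outside `𝓘` has ratio or inverse ratio of size `O(exp(-2μt))`, according
to whether its soliton is slower or faster than `x/t`. Its normalized vector is thus that close to a
coordinate vector, which encodes a vanishing residue. Replacing these vectors by the coordinate
vectors gives exactly the problem on `𝓚(𝓘)`: the factor in `c_j(𝓘)` is what remains of the Blaschke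
factors of the faster outside solitons (`insideData_isSolitonValue`). Lipschitz dependence of `A`
and `B` on bounded normalized vectors (`isBigO_value_sub`) concludes. -/

theorem isLittleO_sub_of_tendsto_sub_mul {h : ℂ → ℂ} {p : ℂ}
    (h0 : Tendsto (fun z => (z - p) * h z) (𝓝[≠] p) (𝓝 0)) :
    (fun z => h z - h p) =o[𝓝[≠] p] fun z => (z - p)⁻¹ := by
  have hne : ∀ᶠ z in 𝓝[≠] p, (z - p)⁻¹ = 0 → h z - h p = 0 := by
    filter_upwards [self_mem_nhdsWithin] with z hz h
    exact absurd (inv_eq_zero.1 h) (sub_ne_zero.2 hz)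
  rw [Asymptotics.isLittleO_iff_tendsto' hne]
  have h1 : Tendsto (fun z => (z - p) * h p) (𝓝[≠] p) (𝓝 0) := by
    have : ContinuousAt (fun z => (z - p) * h p) p := by fun_prop
    simpa using this.tendsto.mono_left nhdsWithin_le_nhds
  have := h0.sub h1
  rw [sub_zero] at this
  refine this.congr fun z => ?_
  rw [div_inv_eq_mul]; ring

theorem exists_tendsto_of_tendsto_sub_mul {h : ℂ → ℂ} {p : ℂ}
    (hd : ∀ᶠ z in 𝓝[≠] p, DifferentiableAt ℂ h z)
    (h0 : Tendsto (fun z => (z - p) * h z) (𝓝[≠] p) (𝓝 0)) :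
    ∃ L, Tendsto h (𝓝[≠] p) (𝓝 L) :=
  ⟨_, Complex.tendsto_limUnder_of_differentiable_on_punctured_nhds_of_isLittleO hd
    (isLittleO_sub_of_tendsto_sub_mul h0)⟩

/-- Singularities are removed one at a time: redefining `h` at `p` by its limit does not affect the
hypotheses at the other points. -/
theorem exists_entire_extension (P : Finset ℂ) (h : ℂ → ℂ)
    (hd : DifferentiableOn ℂ h (P : Set ℂ)ᶜ)
    (h0 : ∀ p ∈ P, Tendsto (fun z => (z - p) * h z) (𝓝[≠] p) (𝓝 0)) :
    ∃ H : ℂ → ℂ, Differentiable ℂ H ∧ ∀ z ∉ P, H z = h z := by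
  induction P using Finset.induction_on generalizing h with
  | empty => exact ⟨h, by simpa [differentiableOn_univ] using hd, fun _ _ => rfl⟩
  | insert p P hp ih =>
    have hopen : (P : Set ℂ)ᶜ ∈ 𝓝 p := P.finite_toSet.isClosed.isOpen_compl.mem_nhds (by simpa)
    have hd' : DifferentiableOn ℂ h ((P : Set ℂ)ᶜ \ {p}) := by
      refine hd.mono fun z hz => ?_
      simp only [Finset.coe_insert, Set.mem_compl_iff, Set.mem_insert_iff, not_or]
      exact ⟨hz.2, hz.1⟩
    obtain ⟨H, hH, hHe⟩ := ih _ (Complex.differentiableOn_update_limUnder_of_isLittleO hopen hd'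
      (isLittleO_sub_of_tendsto_sub_mul (h0 p (by simp)))) fun q hq => by
        have hqp : q ≠ p := fun h => hp (h ▸ hq)
        refine (h0 q (by simp [hq])).congr' ?_
        filter_upwards [nhdsWithin_le_nhds (isOpen_ne.mem_nhds hqp)] with z hz
        rw [Function.update_of_ne hz]
    refine ⟨H, hH, fun z hz => ?_⟩
    simp only [Finset.mem_insert, not_or] at hz
    rw [hHe z hz.2, Function.update_of_ne hz.1]

theorem tendsto_const_div_sub_cobounded (R p : ℂ) :
    Tendsto (fun z => R / (z - p)) (Bornology.cobounded ℂ) (𝓝 0) := by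
  have h : Tendsto (fun z : ℂ => z - p) (Bornology.cobounded ℂ) (Bornology.cobounded ℂ) := by
    rw [← tendsto_norm_atTop_iff_cobounded]
    refine tendsto_atTop_mono (fun z => norm_sub_norm_le z p) ?_
    exact tendsto_atTop_add_const_right _ _ tendsto_norm_cobounded_atTop
  simpa [div_eq_mul_inv] using ((tendsto_inv₀_cobounded (α := ℂ)).comp h).const_mul R

/-- After subtraction of the principal parts every point of `P` is removable, and the entire
extension has a limit at infinity, so it is constant by Liouville. Points of `P` that are not poles
are allowed because the eigenvalues in the upper half plane will be such points. -/
theorem eq_const_add_sum_residues {ι : Type*} (P : Finset ℂ) (f : ℂ → ℂ) (S : Finset ι)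
    (q R : ι → ℂ) (c : ℂ) (hq : Set.InjOn q S) (hqP : ∀ n ∈ S, q n ∈ P)
    (hd : DifferentiableOn ℂ f (P : Set ℂ)ᶜ)
    (hR : ∀ n ∈ S, Tendsto (fun z => (z - q n) * f z) (𝓝[≠] (q n)) (𝓝 (R n)))
    (h0 : ∀ p ∈ P, (∀ n ∈ S, q n ≠ p) → Tendsto (fun z => (z - p) * f z) (𝓝[≠] p) (𝓝 0))
    (hc : Tendsto f (Bornology.cobounded ℂ) (𝓝 c)) :
    ∀ z ∉ P, f z = c + ∑ n ∈ S, R n / (z - q n) := by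
  have hreg : ∀ n p, q n ≠ p → Tendsto (fun z => (z - p) * (R n / (z - q n))) (𝓝[≠] p) (𝓝 0) := by
    intro n p hn
    have : ContinuousAt (fun z => (z - p) * (R n / (z - q n))) p := by
      have : p - q n ≠ 0 := sub_ne_zero.2 hn.symm
      fun_prop (disch := assumption)
    simpa using this.tendsto.mono_left nhdsWithin_le_nhds
  obtain ⟨H, hH, hHe⟩ := exists_entire_extension P (fun z => f z - ∑ n ∈ S, R n / (z - q n)) (by
      refine hd.sub (DifferentiableOn.fun_sum fun n hn z hz => ?_)
      have : z - q n ≠ 0 := sub_ne_zero.2 fun h => hz (by simpa [h] using hqP n hn)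
      fun_prop (disch := assumption)) fun p hp => by
    by_cases hS : ∃ m ∈ S, q m = p
    · obtain ⟨m, hm, rfl⟩ := hS
      classical
      have h1 : Tendsto (fun z => ∑ n ∈ S, (z - q m) * (R n / (z - q n))) (𝓝[≠] (q m))
          (𝓝 (∑ n ∈ S, if n = m then R m else 0)) := by
        refine tendsto_finsetSum _ fun n hn => ?_
        split_ifs with h
        · subst h
          refine tendsto_const_nhds.congr' ?_
          filter_upwards [self_mem_nhdsWithin] with z hz
          have : z - q n ≠ 0 := sub_ne_zero.2 hz
          field_simp
        · exact hreg n (q m) fun h' => h (hq hn hm h')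
      have h2 := (hR m hm).sub h1
      simp only [Finset.sum_ite_eq', hm, if_true, sub_self] at h2
      refine h2.congr fun z => ?_
      rw [mul_sub, Finset.mul_sum]
    · push Not at hS
      have h2 := (h0 p hp hS).sub (tendsto_finsetSum S fun n hn => hreg n p (hS n hn))
      simp only [Finset.sum_const_zero, sub_self] at h2
      refine h2.congr fun z => ?_
      rw [mul_sub, Finset.mul_sum]
  have hlim : Tendsto H (cocompact ℂ) (𝓝 c) := by
    rw [← Metric.cobounded_eq_cocompact]
    have h3 := hc.sub (tendsto_finsetSum S fun n _ => tendsto_const_div_sub_cobounded (R n) (q n))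
    simp only [Finset.sum_const_zero, sub_zero] at h3
    refine h3.congr' ?_
    filter_upwards [Bornology.isBounded_def.1 P.finite_toSet.isBounded] with z hz
    exact (hHe z hz).symm
  intro z hz
  have := hH.apply_eq_of_tendsto_cocompact z hlim
  rw [hHe z hz] at this
  rw [← this]; ring

/-! Coercivity of the Cauchy matrix and of the Gram matrix -/

theorem sub_conj_ne_zero {a b : ℂ} (ha : 0 < a.im) (hb : 0 < b.im) : a - conj b ≠ 0 := by
  intro h
  have := congrArg Complex.im h
  simp at this
  linarith

/-- The Cauchy matrix `i / (k_j - k_n^*)`. -/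
def cauchyGram (k : Fin N → ℂ) : Matrix (Fin N) (Fin N) ℂ :=
  Matrix.of fun j n => Complex.I / (k j - conj (k n))

theorem cauchyGram_isHermitian (k : Fin N → ℂ) : (cauchyGram k).IsHermitian := by
  ext j n
  simp only [cauchyGram, Matrix.conjTranspose_apply, Matrix.of_apply, RCLike.star_def, map_div₀,
    map_sub, Complex.conj_I, Complex.conj_conj]
  rw [← neg_sub, div_neg, neg_div, neg_neg]

/-- The displacement `(k_j - conj k_n) G_{jn} = i` has rank one; it is applied here to an
eigenvector. -/
theorem cauchyGram_displacement {k : Fin N → ℂ} (hkim : ∀ j, 0 < (k j).im) {v : Fin N → ℂ}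
    {l : ℝ} (hv : ∀ j, ∑ n, cauchyGram k j n * v n = l * v j) (j : Fin N) :
    ∑ n, cauchyGram k j n * (conj (k n) * v n) = l * k j * v j - Complex.I * ∑ n, v n := by
  rw [mul_right_comm, ← hv, mul_comm _ (k j), Finset.mul_sum, Finset.mul_sum,
    ← Finset.sum_sub_distrib]
  refine Finset.sum_congr rfl fun n _ => ?_
  have := sub_conj_ne_zero (hkim j) (hkim n)
  simp only [cauchyGram, Matrix.of_apply]
  field_simp
  ring

/-- Pair the displacement identity with `conj v`. Since `G` is Hermitian, the left side can also be
evaluated with `G` acting on the other factor; comparing imaginary parts gives the identity, which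
forces nonnegative eigenvalues. -/
theorem cauchyGram_eigenvector {k : Fin N → ℂ} (hkim : ∀ j, 0 < (k j).im) {v : Fin N → ℂ}
    {l : ℝ} (hv : ∀ j, ∑ n, cauchyGram k j n * v n = l * v j) :
    l * ∑ j, 2 * (k j).im * ‖v j‖ ^ 2 = ‖∑ j, v j‖ ^ 2 := by
  have h1 : ∑ j, conj (v j) * ∑ n, cauchyGram k j n * (conj (k n) * v n) =
      ∑ j, l * conj (k j) * (conj (v j) * v j) := by
    simp_rw [Finset.mul_sum]
    rw [Finset.sum_comm]
    refine Finset.sum_congr rfl fun n _ => ?_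
    have h2 := congrArg conj (hv n)
    rw [map_sum, map_mul, Complex.conj_ofReal] at h2
    calc _ = (conj (k n) * v n) * ∑ j, conj (cauchyGram k n j * v j) := by
          rw [Finset.mul_sum]
          refine Finset.sum_congr rfl fun j _ => ?_
          have := (cauchyGram_isHermitian k).apply j n
          rw [map_mul, ← RCLike.star_def, this]; simp; ring
      _ = _ := by rw [h2]; ring
  simp_rw [cauchyGram_displacement hkim hv, mul_sub, Finset.sum_sub_distrib, ← Finset.sum_mul] at h1
  rw [← map_sum] at h1
  have h3 : (l : ℂ) * ∑ j, (k j - conj (k j)) * (conj (v j) * v j) =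
      Complex.I * (conj (∑ j, v j) * ∑ j, v j) := by
    simp_rw [sub_mul, Finset.sum_sub_distrib, mul_sub]
    rw [Finset.mul_sum, Finset.mul_sum]
    rw [sub_eq_iff_eq_add] at h1 ⊢
    calc _ = ∑ j, conj (v j) * (l * k j * v j) := Finset.sum_congr rfl fun j _ => by ring
      _ = _ := by
        rw [h1, add_comm]
        congr 1
        · ring
        · exact Finset.sum_congr rfl fun j _ => by ring
  simp_rw [Complex.conj_mul', Complex.sub_conj] at h3
  have h4 := congrArg Complex.im h3
  have h5 : (∑ j, (((2 * (k j).im : ℝ) : ℂ) * Complex.I) * (‖v j‖ : ℂ) ^ 2) =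
      ((∑ j, 2 * (k j).im * ‖v j‖ ^ 2 : ℝ) : ℂ) * Complex.I := by
    push_cast
    rw [Finset.sum_mul]
    exact Finset.sum_congr rfl fun j _ => by ring
  rw [h5, ← mul_assoc, ← Complex.ofReal_mul, ← Complex.ofReal_pow, mul_comm Complex.I] at h4
  simpa only [Complex.im_ofReal_mul, Complex.I_im, mul_one] using h4

/-- A kernel vector has entries summing to zero, and by displacement the kernel is stable under
multiplication by `conj k_n`. So all moments `∑ conj(k_n)^m v_n` vanish, and Vandermonde applies to
the distinct nodes. -/
theorem cauchyGram_kernel {k : Fin N → ℂ} (hk : Function.Injective k) (hkim : ∀ j, 0 < (k j).im)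
    {v : Fin N → ℂ} (hv : ∀ j, ∑ n, cauchyGram k j n * v n = 0) : v = 0 := by
  have step : ∀ w : Fin N → ℂ, (∀ j, ∑ n, cauchyGram k j n * w n = 0) →
      ∑ n, w n = 0 ∧ ∀ j, ∑ n, cauchyGram k j n * (conj (k n) * w n) = 0 := by
    intro w hw
    have hw' : ∀ j, ∑ n, cauchyGram k j n * w n = ((0 : ℝ) : ℂ) * w j := by simpa using hw
    have h1 := cauchyGram_eigenvector hkim hw'
    have h2 : ∑ n, w n = 0 := by simpa using h1.symm
    refine ⟨h2, fun j => ?_⟩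
    rw [cauchyGram_displacement hkim hw', h2]; simp
  have hpow : ∀ m : ℕ, ∀ j, ∑ n, cauchyGram k j n * (conj (k n) ^ m * v n) = 0 := by
    intro m
    induction m with
    | zero => simpa using hv
    | succ m ih => simpa only [pow_succ', mul_assoc] using (step _ ih).2
  refine Matrix.eq_zero_of_forall_pow_sum_mul_pow_eq_zero (f := fun j => conj (k j))
    (fun a b h => hk ((starRingEnd ℂ).injective h)) fun i => ?_
  simpa only [mul_comm] using (step _ (hpow i)).1

open ComplexOrder in
theorem cauchyGram_posDef {k : Fin N → ℂ} (hk : Function.Injective k)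
    (hkim : ∀ j, 0 < (k j).im) : (cauchyGram k).PosDef := by
  have hH := cauchyGram_isHermitian k
  rw [hH.posDef_iff_eigenvalues_pos]
  intro i
  set v : Fin N → ℂ := ⇑(hH.eigenvectorBasis i) with hvdef
  have hv : ∀ j, ∑ n, cauchyGram k j n * v n = (hH.eigenvalues i : ℝ) * v j := by
    intro j
    have := congrFun (hH.mulVec_eigenvectorBasis i) j
    simpa [Matrix.mulVec, dotProduct] using this
  have hv0 : v ≠ 0 := by
    intro h
    have h1 := hH.eigenvectorBasis.orthonormal.ne_zero i
    apply h1
    ext j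
    exact congrFun h j
  have h1 := cauchyGram_eigenvector hkim hv
  have hpos : 0 < ∑ j, 2 * (k j).im * ‖v j‖ ^ 2 := by
    obtain ⟨j, hj⟩ := Function.ne_iff.1 hv0
    refine Finset.sum_pos' (fun j _ => ?_) ⟨j, Finset.mem_univ _, ?_⟩
    · have := hkim j; positivity
    · have := hkim j
      have : 0 < ‖v j‖ := norm_pos_iff.2 hj
      positivity
  have hnn : 0 ≤ hH.eigenvalues i := by
    by_contra hneg
    push Not at hneg
    nlinarith [sq_nonneg ‖∑ j, v j‖]
  refine lt_of_le_of_ne hnn fun h0 => hv0 (cauchyGram_kernel hk hkim fun j => ?_)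
  rw [hv, ← h0]; simp

-- The positive definite form attains a positive minimum on the compact unit sphere; homogeneity
-- does the rest.
open ComplexOrder in
theorem cauchyGram_coercive {k : Fin N → ℂ} (hk : Function.Injective k)
    (hkim : ∀ j, 0 < (k j).im) : ∃ l : ℝ, 0 < l ∧ ∀ v : Fin N → ℂ,
      l * ∑ j, ‖v j‖ ^ 2 ≤ (∑ j, ∑ n, conj (v j) * cauchyGram k j n * v n).re := by
  let Q : EuclideanSpace ℂ (Fin N) → ℝ := fun v =>
    (∑ j, ∑ n, conj (v j) * cauchyGram k j n * v n).re
  have hQc : Continuous Q := by fun_prop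
  have hQpos : ∀ v, v ≠ 0 → 0 < Q v := by
    intro v hv
    have h := (cauchyGram_posDef hk hkim).re_dotProduct_pos (x := v.ofLp) (by simpa using hv)
    simpa [Q, dotProduct, Matrix.mulVec, Finset.mul_sum, mul_assoc] using h
  have hcomp : IsCompact (Metric.sphere (0 : EuclideanSpace ℂ (Fin N)) 1) := isCompact_sphere _ _
  -- The sphere is empty only when there are no eigenvalues, and then `v = 0`.
  rcases (Metric.sphere (0 : EuclideanSpace ℂ (Fin N)) 1).eq_empty_or_nonempty with he | hne
  · refine ⟨1, one_pos, fun v => ?_⟩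
    have hN : WithLp.toLp 2 v = 0 := by
      by_contra h
      have : (‖WithLp.toLp 2 v‖⁻¹ : ℂ) • WithLp.toLp 2 v ∈
          Metric.sphere (0 : EuclideanSpace ℂ (Fin N)) 1 := by
        rw [mem_sphere_zero_iff_norm, norm_smul]
        have : ‖WithLp.toLp 2 v‖ ≠ 0 := norm_ne_zero_iff.2 h
        simp [this]
      rw [he] at this
      exact this
    have : v = 0 := by simpa using hN
    simp [this]
  · obtain ⟨w, hw, hmin⟩ := hcomp.exists_isMinOn hne hQc.continuousOn
    have hw0 : w ≠ 0 := by
      rintro rfl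
      simp at hw
    refine ⟨Q w, hQpos w hw0, fun v => ?_⟩
    by_cases hv : WithLp.toLp 2 v = 0
    · have : v = 0 := by simpa using hv
      simp [this]
    · set x : EuclideanSpace ℂ (Fin N) := WithLp.toLp 2 v with hx
      have hxn : ‖x‖ ≠ 0 := norm_ne_zero_iff.2 hv
      have hmem : ((‖x‖⁻¹ : ℝ) : ℂ) • x ∈ Metric.sphere (0 : EuclideanSpace ℂ (Fin N)) 1 := by
        rw [mem_sphere_zero_iff_norm, norm_smul]
        simp [hxn]
      have h1 : Q w ≤ Q (((‖x‖⁻¹ : ℝ) : ℂ) • x) := hmin hmem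
      have h2 : Q (((‖x‖⁻¹ : ℝ) : ℂ) • x) = (‖x‖⁻¹) ^ 2 * Q x := by
        simp only [Q, PiLp.smul_apply, smul_eq_mul, map_mul, Complex.conj_ofReal]
        rw [← Complex.re_ofReal_mul, Finset.mul_sum]
        congr 1
        refine Finset.sum_congr rfl fun j _ => ?_
        rw [Finset.mul_sum]
        refine Finset.sum_congr rfl fun n _ => ?_
        push_cast; ring
      have h3 : ∑ j, ‖v j‖ ^ 2 = ‖x‖ ^ 2 := (EuclideanSpace.norm_sq_eq x).symm
      rw [h3]
      rw [h2] at h1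
      have h4 : Q x = ‖x‖ ^ 2 * ((‖x‖⁻¹) ^ 2 * Q x) := by field_simp
      change _ ≤ Q x
      rw [h4, mul_comm]
      gcongr

/-- The matrix `i (χ_n^† χ_j) / (k_j - k_n^*)`. -/
def gram (k : Fin N → ℂ) (χ : Fin N → Fin 2 → ℂ) : Matrix (Fin N) (Fin N) ℂ :=
  Matrix.of fun j n => cauchyGram k j n * (χ j 0 * conj (χ n 0) + χ j 1 * conj (χ n 1))

/-- The form of `gram k χ` at `v` is the sum of the Cauchy forms at `conj(χ_b) v` for the two
components `b`. Hence `l` depends on `k` alone, which is the source of all uniformity in `(x, t)`.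
-/
theorem gram_coercive {k : Fin N → ℂ} (hk : Function.Injective k)
    (hkim : ∀ j, 0 < (k j).im) : ∃ l : ℝ, 0 < l ∧ ∀ (χ : Fin N → Fin 2 → ℂ) (v : Fin N → ℂ),
      l * ∑ j, (‖χ j 0‖ ^ 2 + ‖χ j 1‖ ^ 2) * ‖v j‖ ^ 2 ≤
        (∑ j, ∑ n, conj (v j) * gram k χ j n * v n).re := by
  obtain ⟨l, hl, h⟩ := cauchyGram_coercive hk hkim
  refine ⟨l, hl, fun χ v => ?_⟩
  have h0 := h fun j => conj (χ j 0) * v j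
  have h1 := h fun j => conj (χ j 1) * v j
  have h2 := add_le_add h0 h1
  rw [← Complex.add_re, ← mul_add, ← Finset.sum_add_distrib, ← Finset.sum_add_distrib] at h2
  refine le_of_eq_of_le ?_ (h2.trans_eq (congrArg Complex.re ?_))
  · refine congrArg _ (Finset.sum_congr rfl fun j _ => ?_)
    simp only [norm_mul, RCLike.norm_conj]; ring
  · refine Finset.sum_congr rfl fun j _ => ?_
    rw [← Finset.sum_add_distrib]
    refine Finset.sum_congr rfl fun n _ => ?_
    simp only [gram, Matrix.of_apply, map_mul, Complex.conj_conj]; ring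

theorem gram_kernel {k : Fin N → ℂ} (hk : Function.Injective k) (hkim : ∀ j, 0 < (k j).im)
    {χ : Fin N → Fin 2 → ℂ} {S : Finset (Fin N)} (hχ : ∀ j ∈ S, χ j ≠ 0) {v : Fin N → ℂ}
    (hv : ∀ j ∈ S, ∑ n ∈ S, gram k χ j n * v n = 0) : ∀ j ∈ S, v j = 0 := by
  obtain ⟨l, hl, h⟩ := gram_coercive hk hkim
  intro j hj
  -- Extending `v` by zero reduces the principal submatrix on `S` to the full matrix.
  have h1 := h χ fun j => if j ∈ S then v j else 0
  have h2 : (∑ j, ∑ n, conj (if j ∈ S then v j else 0) * gram k χ j n *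
      (if n ∈ S then v n else 0)) = 0 := by
    refine Finset.sum_eq_zero fun j _ => ?_
    by_cases hj : j ∈ S
    · simp only [hj, if_true, mul_ite, mul_zero, Finset.sum_ite_mem, Finset.univ_inter]
      simp_rw [mul_assoc, ← Finset.mul_sum, hv j hj, mul_zero]
    · simp [hj]
  rw [h2, Complex.zero_re] at h1
  have hnn : ∀ j ∈ Finset.univ, 0 ≤ (‖χ j 0‖ ^ 2 + ‖χ j 1‖ ^ 2) * ‖if j ∈ S then v j else 0‖ ^ 2 :=
    fun j _ => by positivity
  have h3 : ∑ j, (‖χ j 0‖ ^ 2 + ‖χ j 1‖ ^ 2) * ‖if j ∈ S then v j else 0‖ ^ 2 = 0 :=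
    le_antisymm (nonpos_of_mul_nonpos_right h1 hl) (Finset.sum_nonneg hnn)
  have h4 := (Finset.sum_eq_zero_iff_of_nonneg hnn).1 h3 j (Finset.mem_univ _)
  simp only [hj, if_true] at h4
  rcases mul_eq_zero.1 h4 with h5 | h5
  · exfalso
    apply hχ j hj
    have h6 : ‖χ j 0‖ = 0 := by nlinarith [sq_nonneg ‖χ j 0‖, sq_nonneg ‖χ j 1‖]
    have h7 : ‖χ j 1‖ = 0 := by nlinarith [sq_nonneg ‖χ j 0‖, sq_nonneg ‖χ j 1‖]
    ext i
    fin_cases i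
    · simpa using h6
    · simpa using h7
  · simpa using h5

theorem gram_solvable {k : Fin N → ℂ} (hk : Function.Injective k) (hkim : ∀ j, 0 < (k j).im)
    {χ : Fin N → Fin 2 → ℂ} {S : Finset (Fin N)} (hχ : ∀ j ∈ S, χ j ≠ 0) (q : Fin N → ℂ) :
    ∃ y : Fin N → ℂ, ∀ j ∈ S, ∑ n ∈ S, gram k χ j n * y n = q j := by
  let G : Matrix S S ℂ := (gram k χ).submatrix (fun i => (i : Fin N)) fun i => (i : Fin N)
  have hinj : Function.Injective G.mulVecLin := by
    rw [injective_iff_map_eq_zero]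
    intro v hv
    have h1 := gram_kernel hk hkim hχ (v := fun j => if h : j ∈ S then v ⟨j, h⟩ else 0)
      fun j hj => by
        rw [← Finset.sum_coe_sort]
        simpa [G, Matrix.mulVec, dotProduct] using congrFun hv ⟨j, hj⟩
    ext j
    simpa using h1 j j.2
  obtain ⟨v, hv⟩ := (LinearMap.injective_iff_surjective.1 hinj) fun j => q j
  refine ⟨fun j => if h : j ∈ S then v ⟨j, h⟩ else 0, fun j hj => ?_⟩
  rw [← Finset.sum_coe_sort]
  simpa [G, Matrix.mulVec, dotProduct] using congrFun hv ⟨j, hj⟩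

/-! Blaschke products -/

theorem tendsto_conj_nhdsNE (p : ℂ) : Tendsto conj (𝓝[≠] (conj p)) (𝓝[≠] p) := by
  refine tendsto_nhdsWithin_iff.2 ⟨?_, ?_⟩
  · have : Tendsto conj (𝓝 (conj p)) (𝓝 (conj (conj p))) := Complex.continuous_conj.tendsto _
    rw [Complex.conj_conj] at this
    exact this.mono_left nhdsWithin_le_nhds
  · filter_upwards [self_mem_nhdsWithin] with z hz h
    refine hz ?_
    rw [← (show conj z = p from h), Set.mem_singleton_iff, Complex.conj_conj]

theorem tendsto_conj_nhdsNE' (p : ℂ) : Tendsto conj (𝓝[≠] p) (𝓝[≠] (conj p)) := by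
  simpa using tendsto_conj_nhdsNE (conj p)

/-- The derivative of `s11 k A` at its zero `k j`. -/
def s11Deriv (k : Fin N → ℂ) (A : Finset (Fin N)) (j : Fin N) : ℂ :=
  s11 k (A.erase j) (k j) / (k j - conj (k j))

theorem s11_ne_zero {k : Fin N → ℂ} {A : Finset (Fin N)} {z : ℂ} (h : ∀ n ∈ A, z ≠ k n)
    (h' : ∀ n ∈ A, z ≠ conj (k n)) : s11 k A z ≠ 0 :=
  Finset.prod_ne_zero_iff.2 fun n hn =>
    div_ne_zero (sub_ne_zero.2 (h n hn)) (sub_ne_zero.2 (h' n hn))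

theorem ne_conj_of_im_pos {a b : ℂ} (ha : 0 < a.im) (hb : 0 < b.im) : a ≠ conj b :=
  sub_ne_zero.1 (sub_conj_ne_zero ha hb)

theorem s11_pole_ne_zero {k : Fin N → ℂ} (hk : Function.Injective k) (hkim : ∀ j, 0 < (k j).im)
    {A : Finset (Fin N)} {j : Fin N} (hj : j ∉ A) : s11 k A (k j) ≠ 0 :=
  s11_ne_zero (fun _ hn h => hj (hk h ▸ hn)) fun n _ => ne_conj_of_im_pos (hkim j) (hkim n)

theorem s11Deriv_ne_zero {k : Fin N → ℂ} (hk : Function.Injective k) (hkim : ∀ j, 0 < (k j).im)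
    (A : Finset (Fin N)) (j : Fin N) : s11Deriv k A j ≠ 0 :=
  div_ne_zero (s11_pole_ne_zero hk hkim (Finset.notMem_erase j A))
    (sub_conj_ne_zero (hkim j) (hkim j))

theorem s11_conj (k : Fin N → ℂ) (A : Finset (Fin N)) (z : ℂ) :
    s11 k A (conj z) = (conj (s11 k A z))⁻¹ := by
  simp only [s11, map_prod, ← Finset.prod_inv_distrib]
  refine Finset.prod_congr rfl fun n _ => ?_
  simp

theorem differentiableAt_s11 {k : Fin N → ℂ} {A : Finset (Fin N)} {z : ℂ}
    (h' : ∀ n ∈ A, z ≠ conj (k n)) : DifferentiableAt ℂ (s11 k A) z := by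
  unfold s11
  refine DifferentiableAt.fun_finsetProd fun n hn => ?_
  have := sub_ne_zero.2 (h' n hn)
  fun_prop (disch := assumption)

theorem s11_eq_mul_erase {k : Fin N → ℂ} {A : Finset (Fin N)} {j : Fin N} (hj : j ∈ A) (z : ℂ) :
    s11 k A z = (z - k j) / (z - conj (k j)) * s11 k (A.erase j) z :=
  (Finset.mul_prod_erase A _ hj).symm

theorem s11_union {k : Fin N → ℂ} {A B : Finset (Fin N)} (h : Disjoint A B) (z : ℂ) :
    s11 k (A ∪ B) z = s11 k A z * s11 k B z :=
  Finset.prod_union h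

theorem s11Deriv_union {k : Fin N → ℂ} {A B : Finset (Fin N)} (h : Disjoint A B) {j : Fin N}
    (hj : j ∈ A) : s11Deriv k (A ∪ B) j = s11Deriv k A j * s11 k B (k j) := by
  have hB : j ∉ B := Finset.disjoint_left.1 h hj
  rw [s11Deriv, s11Deriv, Finset.erase_union_distrib, Finset.erase_eq_of_notMem hB,
    s11_union (h.mono_left (Finset.erase_subset _ _))]
  ring

theorem hasDerivAt_s11 {k : Fin N → ℂ} (hkim : ∀ j, 0 < (k j).im)
    {A : Finset (Fin N)} {j : Fin N} (hj : j ∈ A) :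
    HasDerivAt (s11 k A) (s11Deriv k A j) (k j) := by
  have h1 : ∀ n, k j ≠ conj (k n) := fun n => ne_conj_of_im_pos (hkim j) (hkim n)
  have hne := sub_ne_zero.2 (h1 j)
  have h2 : HasDerivAt (fun z => z - k j) 1 (k j) := (hasDerivAt_id _).sub_const _
  have h3 : DifferentiableAt ℂ (fun z => s11 k (A.erase j) z / (z - conj (k j))) (k j) :=
    (differentiableAt_s11 fun n _ => h1 n).fun_div (by fun_prop) hne
  have h4 := h2.fun_mul h3.hasDerivAt
  simp only [sub_self, zero_mul, add_zero, one_mul] at h4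
  refine h4.congr_of_eventuallyEq (Eventually.of_forall fun z => ?_)
  rw [s11_eq_mul_erase hj]; ring

theorem tendsto_s11_div_sub {k : Fin N → ℂ} (hkim : ∀ j, 0 < (k j).im)
    {A : Finset (Fin N)} {j : Fin N} (hj : j ∈ A) :
    Tendsto (fun z => s11 k A z / (z - k j)) (𝓝[≠] (k j)) (𝓝 (s11Deriv k A j)) := by
  have h := (hasDerivAt_s11 hkim hj).tendsto_slope
  refine h.congr fun z => ?_
  have h0 : s11 k A (k j) = 0 := by rw [s11_eq_mul_erase hj]; simp
  rw [slope_def_field, h0, sub_zero]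

/-- By `s11_conj` the pole at `conj k_j` is the reflection of the zero at `k_j`. -/
theorem tendsto_sub_mul_s11 {k : Fin N → ℂ} (hk : Function.Injective k)
    (hkim : ∀ j, 0 < (k j).im) {A : Finset (Fin N)} {j : Fin N} (hj : j ∈ A) :
    Tendsto (fun z => (z - conj (k j)) * s11 k A z) (𝓝[≠] (conj (k j)))
      (𝓝 (conj (s11Deriv k A j))⁻¹) := by
  have h := (tendsto_s11_div_sub hkim hj).comp (tendsto_conj_nhdsNE (k j))
  have h2 := ((Complex.continuous_conj.tendsto _).comp h).inv₀
    ((map_ne_zero _).2 (s11Deriv_ne_zero hk hkim A j))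
  refine h2.congr fun z => ?_
  simp only [Function.comp_apply, s11_conj, map_div₀, map_inv₀, map_sub, Complex.conj_conj]
  rw [inv_div, div_inv_eq_mul]

theorem isBigO_div_sub (R p : ℂ) :
    (fun z => R / (z - p)) =O[Bornology.cobounded ℂ] fun z => z⁻¹ := by
  have h : (fun z : ℂ => p) =o[Bornology.cobounded ℂ] fun z : ℂ => z :=
    Asymptotics.isLittleO_const_left.2 (Or.inr tendsto_norm_cobounded_atTop)
  have h1 : (fun z : ℂ => z) =O[Bornology.cobounded ℂ] fun z : ℂ => z - p := by
    exact (Asymptotics.IsEquivalent.refl.sub_isLittleO h).isBigO_symm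
  have h2 := h1.inv_rev (by
    filter_upwards [Bornology.eventually_ne_cobounded (0 : ℂ)] with z hz h
    exact absurd h hz)
  simpa [div_eq_mul_inv] using h2.const_mul_left R

theorem tendsto_inv_cobounded_zero : Tendsto (fun z : ℂ => z⁻¹) (Bornology.cobounded ℂ) (𝓝 0) :=
  tendsto_inv₀_cobounded

theorem tendsto_of_isBigO_inv {f : ℂ → ℂ} {c : ℂ}
    (h : (fun z => f z - c) =O[Bornology.cobounded ℂ] fun z => z⁻¹) :
    Tendsto f (Bornology.cobounded ℂ) (𝓝 c) := by
  simpa using (h.trans_tendsto tendsto_inv_cobounded_zero).add_const c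

theorem isBigO_mul_sub_one {f g : ℂ → ℂ} {c : ℂ}
    (hf : (fun z => f z - c) =O[Bornology.cobounded ℂ] fun z => z⁻¹)
    (hg : (fun z => g z - 1) =O[Bornology.cobounded ℂ] fun z => z⁻¹) :
    (fun z => f z * g z - c) =O[Bornology.cobounded ℂ] fun z => z⁻¹ := by
  have h1 := (hf.mul ((tendsto_of_isBigO_inv hg).isBigO_one ℂ))
  simp only [mul_one] at h1
  have h2 := h1.add (hg.const_mul_left c)
  refine h2.congr_left fun z => ?_
  ring

theorem isBigO_s11_sub_one (k : Fin N → ℂ) (A : Finset (Fin N)) :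
    (fun z => s11 k A z - 1) =O[Bornology.cobounded ℂ] fun z => z⁻¹ := by
  unfold s11
  induction A using Finset.induction_on with
  | empty => simpa using Asymptotics.isBigO_zero _ _
  | insert n A hn ih =>
    simp_rw [Finset.prod_insert hn]
    refine isBigO_mul_sub_one ?_ ih
    refine (isBigO_div_sub (conj (k n) - k n) (conj (k n))).congr' ?_ EventuallyEq.rfl
    filter_upwards [Bornology.eventually_ne_cobounded (conj (k n))] with z hz
    have := sub_ne_zero.2 hz
    field_simp
    ring

theorem tendsto_s11_cobounded (k : Fin N → ℂ) (A : Finset (Fin N)) :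
    Tendsto (s11 k A) (Bornology.cobounded ℂ) (𝓝 1) :=
  tendsto_of_isBigO_inv (isBigO_s11_sub_one k A)

theorem isBigO_inv_s11_sub_one (k : Fin N → ℂ) (A : Finset (Fin N)) :
    (fun z => (s11 k A z)⁻¹ - 1) =O[Bornology.cobounded ℂ] fun z => z⁻¹ := by
  have h := tendsto_s11_cobounded k A
  have h1 := (((h.inv₀ one_ne_zero).neg).isBigO_one ℂ).mul (isBigO_s11_sub_one k A)
  simp only [one_mul] at h1
  refine h1.congr' ?_ EventuallyEq.rfl
  filter_upwards [h.eventually_ne one_ne_zero] with z hz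
  field_simp
  ring

/-! The Riemann-Hilbert problem without the symmetry condition -/

/-- The indices of the zeros of the weight of the column `c`. -/
def SolitonData.column (D : SolitonData N) (c : Fin 2) : Finset (Fin N) :=
  if c = 0 then D.index \ D.nabla else D.nabla

/-- The nonzero entry of the residue matrix at `k_j`. -/
def SolitonData.entry (D : SolitonData N) (α x t : ℝ) (j : Fin N) : ℂ :=
  D.coeff j * Complex.exp ((if j ∈ D.nabla then -2 else 2) * Complex.I * tTheta α x t (D.pole j))

/-- The conditions on reflectionless data under which the problem is well posed. -/
structure SolitonData.Admissible (D : SolitonData N) : Prop where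
  injective : Function.Injective D.pole
  im_pos : ∀ j, 0 < (D.pole j).im
  subset : D.nabla ⊆ D.index

theorem conj_tTheta (α x t : ℝ) (z : ℂ) : conj (tTheta α x t z) = tTheta α x t (conj z) := by
  simp [tTheta, map_ofNat]

/-- Treats `j ∈ ∇` and `j ∉ ∇` at once: `c` is the column singular at `k_j`, and `c'` is the column
singular at `conj k_j`. -/
theorem SolitonData.exists_column (D : SolitonData N) {j : Fin N} (hj : j ∈ D.index) (α x t : ℝ) :
    ∃ c c' : Fin 2, c ≠ c' ∧ j ∈ D.column c ∧ j ∉ D.column c' ∧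
      D.residueMatrix α x t j = Matrix.single c' c (D.entry α x t j) ∧
      D.residueMatrixConj α x t j = Matrix.single c c' (-conj (D.entry α x t j)) := by
  by_cases h : j ∈ D.nabla
  · refine ⟨1, 0, by decide, by simp [column, h], by simp [column, h], ?_, ?_⟩
    · ext a b
      fin_cases a <;> fin_cases b <;> simp [residueMatrix, h, entry, Matrix.single]
    · ext a b
      fin_cases a <;> fin_cases b <;>
        simp [residueMatrixConj, h, entry, Matrix.single, ← Complex.exp_conj, conj_tTheta, map_ofNat]
  · refine ⟨0, 1, by decide, by simp [column, h, hj], by simp [column, h], ?_, ?_⟩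
    · ext a b
      fin_cases a <;> fin_cases b <;> simp [residueMatrix, h, entry, Matrix.single]
    · ext a b
      fin_cases a <;> fin_cases b <;>
        simp [residueMatrixConj, h, entry, Matrix.single, ← Complex.exp_conj, conj_tTheta, map_ofNat]

/-- `M` satisfies all the conditions of the discrete Riemann-Hilbert problem except the symmetry. -/
structure SolvesWeakRHP (α : ℝ) (D : SolitonData N) (x t : ℝ)
    (M : ℂ → Matrix (Fin 2) (Fin 2) ℂ) : Prop where
  analytic : ∀ a b, DifferentiableOn ℂ (fun z => M z a b) D.polesᶜ
  limit : ∀ a b, Tendsto (fun z => M z a b) (Bornology.cobounded ℂ)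
    (𝓝 ((1 : Matrix (Fin 2) (Fin 2) ℂ) a b))
  residue : ∀ j ∈ D.index, HasResidueRelation M (D.pole j) (D.residueMatrix α x t j)
  residue_conj : ∀ j ∈ D.index,
    HasResidueRelation M (conj (D.pole j)) (D.residueMatrixConj α x t j)

theorem SolvesRHP.weak {α : ℝ} {D : SolitonData N} {x t : ℝ} {M : ℂ → Matrix (Fin 2) (Fin 2) ℂ}
    (h : SolvesRHP α D x t M) : SolvesWeakRHP α D x t M where
  analytic := h.analytic
  limit a b := tendsto_of_isBigO_inv (h.asymptotics a b)
  residue := h.residue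
  residue_conj := h.residue_conj

/-- Column `c'` of `M Θ` is zero, so uniqueness of limits kills the residue of column `c'` of `M`;
that column then has a removable singularity wherever `M` is analytic nearby. -/
theorem hasResidueRelation_single_iff {M : ℂ → Matrix (Fin 2) (Fin 2) ℂ} {p E : ℂ} {c c' : Fin 2}
    (hc : c ≠ c') : HasResidueRelation M p (Matrix.single c' c E) ↔
      ∀ i, ∃ R, Tendsto (fun z => (z - p) * M z i c) (𝓝[≠] p) (𝓝 R) ∧
        Tendsto (fun z => (z - p) * M z i c') (𝓝[≠] p) (𝓝 0) ∧
        Tendsto (fun z => M z i c' * E) (𝓝[≠] p) (𝓝 R) := by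
  have hcase : ∀ b, b = c ∨ b = c' := by omega
  constructor
  · rintro ⟨R, h1, h2⟩ i
    have h1' := fun b => tendsto_pi_nhds.1 (tendsto_pi_nhds.1 h1 i) b
    have h2' := fun b => tendsto_pi_nhds.1 (tendsto_pi_nhds.1 h2 i) b
    have h3 := h2' c'
    have h4 := h2' c
    simp only [Matrix.mul_single_apply_of_ne _ _ _ _ _ hc.symm, Matrix.mul_single_apply_same] at h3 h4
    have h5 := h1' c'
    rw [tendsto_nhds_unique h3 tendsto_const_nhds] at h5
    exact ⟨R i c, by simpa using h1' c, by simpa using h5, h4⟩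
  · intro h
    choose R h1 h2 h3 using h
    refine ⟨Matrix.of fun i b => if b = c then R i else 0,
      tendsto_pi_nhds.2 fun i => tendsto_pi_nhds.2 fun b => ?_,
      tendsto_pi_nhds.2 fun i => tendsto_pi_nhds.2 fun b => ?_⟩
    · rcases hcase b with rfl | rfl
      · simpa using h1 i
      · simpa [hc.symm] using h2 i
    · rcases hcase b with rfl | rfl
      · simpa using h3 i
      · simp [hc.symm, Matrix.mul_single_apply_of_ne _ _ _ _ _ hc.symm]

/-- `χ j` spans the kernel at `k_j` of the solution whose columns are multiplied by the Blaschke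
products that remove the poles in the upper half plane. -/
def Represents (α : ℝ) (D : SolitonData N) (x t : ℝ) (χ : Fin N → Fin 2 → ℂ) : Prop :=
  ∀ j ∈ D.index, χ j ≠ 0 ∧ ∀ c c', c ≠ c' → j ∈ D.column c →
    χ j c' * s11 D.pole (D.column c') (D.pole j) =
      -(D.entry α x t j * s11Deriv D.pole (D.column c) j * χ j c)

/-- The rows `y i` are the solutions of the linear systems with the Gram matrix of `χ`. -/
def SolvesGram (k : Fin N → ℂ) (S : Finset (Fin N)) (χ : Fin N → Fin 2 → ℂ)
    (y : Fin 2 → Fin N → ℂ) : Prop :=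
  ∀ i, ∀ j ∈ S, ∑ n ∈ S, gram k χ j n * y i n = Complex.I * χ j i

/-- The entries of the regularized solution. -/
def dressedEntry (k : Fin N → ℂ) (S : Finset (Fin N)) (χ : Fin N → Fin 2 → ℂ)
    (y : Fin 2 → Fin N → ℂ) (z : ℂ) (i c : Fin 2) : ℂ :=
  (1 : Matrix (Fin 2) (Fin 2) ℂ) i c + ∑ n ∈ S, -(y i n * conj (χ n c)) / (z - conj (k n))

/-- The explicit solution of the discrete Riemann-Hilbert problem. -/
def dressed (D : SolitonData N) (χ : Fin N → Fin 2 → ℂ) (y : Fin 2 → Fin N → ℂ) (z : ℂ) :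
    Matrix (Fin 2) (Fin 2) ℂ :=
  Matrix.of fun i c => dressedEntry D.pole D.index χ y z i c / s11 D.pole (D.column c) z

/-- Pairing the partial fractions at `k_j` with `χ_j` gives `χ_{ji} + i (G y_i)_j`, because `i · i /
(k_j - conj k_n) = -1 / (k_j - conj k_n)`. -/
theorem kernel_iff_gram {k : Fin N → ℂ} (S : Finset (Fin N))
    (χ : Fin N → Fin 2 → ℂ) (y : Fin 2 → Fin N → ℂ) (i : Fin 2) (j : Fin N) {c c' : Fin 2}
    (hc : c ≠ c') :
    dressedEntry k S χ y (k j) i c * χ j c + dressedEntry k S χ y (k j) i c' * χ j c' = 0 ↔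
      ∑ n ∈ S, gram k χ j n * y i n = Complex.I * χ j i := by
  have h1 : dressedEntry k S χ y (k j) i c * χ j c + dressedEntry k S χ y (k j) i c' * χ j c' =
      dressedEntry k S χ y (k j) i 0 * χ j 0 + dressedEntry k S χ y (k j) i 1 * χ j 1 := by
    rcases (by omega : (c = 0 ∧ c' = 1) ∨ (c = 1 ∧ c' = 0)) with ⟨rfl, rfl⟩ | ⟨rfl, rfl⟩
    · rfl
    · rw [add_comm]
  have h2 : dressedEntry k S χ y (k j) i 0 * χ j 0 + dressedEntry k S χ y (k j) i 1 * χ j 1 =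
      χ j i + Complex.I * ∑ n ∈ S, gram k χ j n * y i n := by
    simp only [dressedEntry, add_mul, Finset.sum_mul, Finset.mul_sum]
    rw [add_add_add_comm, ← Finset.sum_add_distrib]
    congr 1
    · rcases (by omega : i = 0 ∨ i = 1) with rfl | rfl <;> simp
    · refine Finset.sum_congr rfl fun n _ => ?_
      simp only [gram, cauchyGram, Matrix.of_apply]
      linear_combination (-(y i n) * (χ j 0 * conj (χ n 0) + χ j 1 * conj (χ n 1)) /
        (k j - conj (k n))) * Complex.I_mul_I
  rw [h1, h2]
  constructor
  · intro h
    linear_combination (-Complex.I) * h + (-∑ n ∈ S, gram k χ j n * y i n) * (-Complex.I_mul_I)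
  · intro h
    rw [h]
    linear_combination χ j i * Complex.I_mul_I

/-! Unique solvability of the discrete Riemann-Hilbert problem -/

theorem fin_two_eq_or {c c' : Fin 2} (hc : c ≠ c') (b : Fin 2) : b = c ∨ b = c' := by omega

/-- The poles as a finite set. -/
def SolitonData.poleFinset (D : SolitonData N) : Finset ℂ :=
  D.index.image D.pole ∪ D.index.image fun j => conj (D.pole j)

theorem SolitonData.mem_poleFinset {D : SolitonData N} {z : ℂ} :
    z ∈ D.poleFinset ↔ z ∈ D.poles := by
  simp only [poleFinset, poles, Finset.mem_union, Finset.mem_image, Set.mem_ofPred_eq]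
  constructor
  · rintro (⟨j, hj, rfl⟩ | ⟨j, hj, rfl⟩)
    exacts [⟨j, hj, Or.inl rfl⟩, ⟨j, hj, Or.inr rfl⟩]
  · rintro ⟨j, hj, rfl | rfl⟩
    exacts [Or.inl ⟨j, hj, rfl⟩, Or.inr ⟨j, hj, rfl⟩]

theorem SolitonData.coe_poleFinset (D : SolitonData N) : (D.poleFinset : Set ℂ) = D.poles :=
  Set.ext fun _ => mem_poleFinset

theorem SolitonData.isOpen_compl_poles (D : SolitonData N) : IsOpen D.polesᶜ := by
  rw [← coe_poleFinset]
  exact D.poleFinset.finite_toSet.isClosed.isOpen_compl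

theorem SolitonData.eventually_notMem_poles (D : SolitonData N) (p : ℂ) :
    ∀ᶠ z in 𝓝[≠] p, z ∉ D.poles := by
  rw [← coe_poleFinset]
  have h := (D.poleFinset.finite_toSet.subset
    (Set.sdiff_subset (t := {p}))).isClosed.isOpen_compl.mem_nhds (x := p) (by simp)
  filter_upwards [nhdsWithin_le_nhds h, self_mem_nhdsWithin] with z hz hzp hm
  exact hz ⟨hm, hzp⟩

theorem SolitonData.eventually_cobounded_notMem_poles (D : SolitonData N) :
    ∀ᶠ z in Bornology.cobounded ℂ, z ∉ D.poles := by
  rw [← coe_poleFinset]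
  exact Bornology.isBounded_def.1 D.poleFinset.finite_toSet.isBounded

theorem SolitonData.ne_pole {D : SolitonData N} {z : ℂ} (hz : z ∉ D.poles) {n : Fin N}
    (hn : n ∈ D.index) : z ≠ D.pole n := fun h => hz ⟨n, hn, Or.inl h⟩

theorem SolitonData.ne_conj_pole {D : SolitonData N} {z : ℂ} (hz : z ∉ D.poles) {n : Fin N}
    (hn : n ∈ D.index) : z ≠ conj (D.pole n) := fun h => hz ⟨n, hn, Or.inr h⟩

theorem SolitonData.Admissible.column_subset {D : SolitonData N} (hD : D.Admissible) (c : Fin 2) :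
    D.column c ⊆ D.index := by
  unfold SolitonData.column
  split_ifs
  · exact Finset.sdiff_subset
  · exact hD.subset

theorem SolitonData.Admissible.weight_ne_zero {D : SolitonData N} (hD : D.Admissible) {z : ℂ}
    (hz : z ∉ D.poles) (c : Fin 2) : s11 D.pole (D.column c) z ≠ 0 :=
  s11_ne_zero (fun _ hn => D.ne_pole hz (hD.column_subset c hn))
    fun _ hn => D.ne_conj_pole hz (hD.column_subset c hn)

theorem SolitonData.Admissible.differentiableAt_weight {D : SolitonData N} (hD : D.Admissible)
    {z : ℂ} (hz : z ∉ D.poles) (c : Fin 2) :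
    DifferentiableAt ℂ (s11 D.pole (D.column c)) z :=
  differentiableAt_s11 fun _ hn => D.ne_conj_pole hz (hD.column_subset c hn)

theorem SolitonData.Admissible.tendsto_weight {D : SolitonData N} (hD : D.Admissible) (j : Fin N)
    (c : Fin 2) : Tendsto (s11 D.pole (D.column c)) (𝓝[≠] (D.pole j))
      (𝓝 (s11 D.pole (D.column c) (D.pole j))) :=
  (differentiableAt_s11 fun n _ =>
    ne_conj_of_im_pos (hD.im_pos j) (hD.im_pos n)).continuousAt.tendsto.mono_left nhdsWithin_le_nhds

theorem SolitonData.Admissible.tendsto_weight_conj {D : SolitonData N} (hD : D.Admissible)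
    {j : Fin N} {c : Fin 2} (hj : j ∉ D.column c) :
    Tendsto (s11 D.pole (D.column c)) (𝓝[≠] (conj (D.pole j)))
      (𝓝 (conj (s11 D.pole (D.column c) (D.pole j)))⁻¹) := by
  have h := (Complex.continuous_conj.tendsto _).comp
    ((hD.tendsto_weight j c).comp (tendsto_conj_nhdsNE _))
  refine (h.inv₀ ((map_ne_zero _).2 (s11_pole_ne_zero hD.injective hD.im_pos hj))).congr fun z => ?_
  simp [s11_conj]

theorem Represents.apply_ne_zero {α x t : ℝ} {D : SolitonData N} {χ : Fin N → Fin 2 → ℂ}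
    (hD : D.Admissible) (h : Represents α D x t χ) {j : Fin N} (hj : j ∈ D.index) {c c' : Fin 2}
    (hc : c ≠ c') (hjc : j ∈ D.column c) (hjc' : j ∉ D.column c') : χ j c ≠ 0 := by
  intro h0
  obtain ⟨h1, h2⟩ := h j hj
  have h3 := h2 c c' hc hjc
  rw [h0, mul_zero, neg_zero, mul_eq_zero] at h3
  have h4 := h3.resolve_right (s11_pole_ne_zero hD.injective hD.im_pos hjc')
  apply h1
  ext b
  rcases fin_two_eq_or hc b with rfl | rfl
  · simpa using h0
  · simpa using h4

theorem differentiableAt_dressedEntry {k : Fin N → ℂ} {S : Finset (Fin N)}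
    (χ : Fin N → Fin 2 → ℂ) (y : Fin 2 → Fin N → ℂ) (i c : Fin 2) {z : ℂ}
    (hz : ∀ n ∈ S, z ≠ conj (k n)) :
    DifferentiableAt ℂ (fun z => dressedEntry k S χ y z i c) z := by
  refine (differentiableAt_const _).fun_add (DifferentiableAt.fun_sum fun n hn => ?_)
  have := sub_ne_zero.2 (hz n hn)
  fun_prop (disch := assumption)

/-- In column `c` the zero of the weight cancels the pole, and column `c'` is already regular. The
residue relation then says that the row of limits is orthogonal to `χ_j`, without conjugation. -/
theorem SolvesWeakRHP.tendsto_pole {α x t : ℝ} {D : SolitonData N}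
    {M : ℂ → Matrix (Fin 2) (Fin 2) ℂ} (hD : D.Admissible) (h : SolvesWeakRHP α D x t M)
    {χ : Fin N → Fin 2 → ℂ} (hχ : Represents α D x t χ) (i : Fin 2) {j : Fin N}
    (hj : j ∈ D.index) : ∃ L : Fin 2 → ℂ,
      (∀ c, Tendsto (fun z => M z i c * s11 D.pole (D.column c) z) (𝓝[≠] (D.pole j)) (𝓝 (L c))) ∧
      L 0 * χ j 0 + L 1 * χ j 1 = 0 := by
  obtain ⟨c, c', hc, hjc, hjc', hΘ, -⟩ := D.exists_column hj α x t
  have h1 := h.residue j hj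
  rw [hΘ, hasResidueRelation_single_iff hc] at h1
  obtain ⟨R, hR, hR0, hRE⟩ := h1 i
  obtain ⟨G, hG⟩ := exists_tendsto_of_tendsto_sub_mul (h := fun z => M z i c') (by
    filter_upwards [D.eventually_notMem_poles (D.pole j)] with z hz
    exact (h.analytic i c').differentiableAt (D.isOpen_compl_poles.mem_nhds hz)) hR0
  have hGR : G * D.entry α x t j = R := tendsto_nhds_unique (hG.mul_const _) hRE
  have hd := tendsto_s11_div_sub hD.im_pos hjc
  have h2 := hR.mul hd
  have h3 := hG.mul (hD.tendsto_weight j c')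
  refine ⟨fun b => if b = c then R * s11Deriv D.pole (D.column c) j
    else G * s11 D.pole (D.column c') (D.pole j), fun b => ?_, ?_⟩
  · rcases fin_two_eq_or hc b with rfl | rfl
    · simp only [if_true]
      refine h2.congr' ?_
      filter_upwards [self_mem_nhdsWithin] with z hz
      have : z - D.pole j ≠ 0 := sub_ne_zero.2 hz
      field_simp
    · simpa [hc.symm] using h3
  · have h4 := (hχ j hj).2 c c' hc hjc
    have h5 : R * s11Deriv D.pole (D.column c) j * χ j c +
        G * s11 D.pole (D.column c') (D.pole j) * χ j c' = 0 := by
      rw [← hGR]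
      linear_combination G * h4
    rcases (by omega : (c = 0 ∧ c' = 1) ∨ (c = 1 ∧ c' = 0)) with ⟨rfl, rfl⟩ | ⟨rfl, rfl⟩
    · simpa using h5
    · simpa [add_comm] using h5

/-- At `conj k_j` one column is singular through its weight and the other through `M`. The conjugate
of the relation defining `χ_j` makes the two residues proportional to `conj χ_j`. -/
theorem SolvesWeakRHP.tendsto_conj_pole {α x t : ℝ} {D : SolitonData N}
    {M : ℂ → Matrix (Fin 2) (Fin 2) ℂ} (hD : D.Admissible) (h : SolvesWeakRHP α D x t M)
    {χ : Fin N → Fin 2 → ℂ} (hχ : Represents α D x t χ) (i : Fin 2) {j : Fin N}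
    (hj : j ∈ D.index) : ∃ w : ℂ, ∀ c, Tendsto
      (fun z => (z - conj (D.pole j)) * (M z i c * s11 D.pole (D.column c) z))
      (𝓝[≠] (conj (D.pole j))) (𝓝 (-(w * conj (χ j c)))) := by
  obtain ⟨c, c', hc, hjc, hjc', -, hΘ⟩ := D.exists_column hj α x t
  have h1 := h.residue_conj j hj
  rw [hΘ, hasResidueRelation_single_iff hc.symm] at h1
  obtain ⟨R, hR, hR0, hRE⟩ := h1 i
  obtain ⟨F, hF⟩ := exists_tendsto_of_tendsto_sub_mul (h := fun z => M z i c) (by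
    filter_upwards [D.eventually_notMem_poles (conj (D.pole j))] with z hz
    exact (h.analytic i c).differentiableAt (D.isOpen_compl_poles.mem_nhds hz)) hR0
  have hFR : F * -conj (D.entry α x t j) = R := tendsto_nhds_unique (hF.mul_const _) hRE
  have h2 := hF.mul (tendsto_sub_mul_s11 hD.injective hD.im_pos hjc)
  have h3 := hR.mul (hD.tendsto_weight_conj hjc')
  have hχc : conj (χ j c) ≠ 0 := (map_ne_zero _).2 (hχ.apply_ne_zero hD hj hc hjc hjc')
  have hd : conj (s11Deriv D.pole (D.column c) j) ≠ 0 :=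
    (map_ne_zero _).2 (s11Deriv_ne_zero hD.injective hD.im_pos _ _)
  have he : conj (s11 D.pole (D.column c') (D.pole j)) ≠ 0 :=
    (map_ne_zero _).2 (s11_pole_ne_zero hD.injective hD.im_pos hjc')
  have h4 := congrArg conj ((hχ j hj).2 c c' hc hjc)
  simp only [map_mul, map_neg] at h4
  refine ⟨-(F * (conj (s11Deriv D.pole (D.column c) j))⁻¹) / conj (χ j c), fun b => ?_⟩
  rcases fin_two_eq_or hc b with rfl | rfl
  · have : -(-(F * (conj (s11Deriv D.pole (D.column b) j))⁻¹) / conj (χ j b) * conj (χ j b)) =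
        F * (conj (s11Deriv D.pole (D.column b) j))⁻¹ := by field_simp
    rw [this]
    exact h2.congr fun z => by ring
  · have : -(-(F * (conj (s11Deriv D.pole (D.column c) j))⁻¹) / conj (χ j c) * conj (χ j b)) =
        R * (conj (s11 D.pole (D.column b) (D.pole j)))⁻¹ := by
      rw [← hFR]
      field_simp
      linear_combination F * h4
    rw [this]
    exact h3.congr fun z => by ring

/-- Uniqueness: the weighted rows are partial fractions with unknown residue factors `w`, the
conditions at the `k_j` are a Gram system for `w`, and that system has trivial kernel. The symmetry
condition plays no role. -/
theorem SolvesWeakRHP.eq_dressed {α x t : ℝ} {D : SolitonData N}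
    {M : ℂ → Matrix (Fin 2) (Fin 2) ℂ} (hD : D.Admissible) (h : SolvesWeakRHP α D x t M)
    {χ : Fin N → Fin 2 → ℂ} (hχ : Represents α D x t χ) {y : Fin 2 → Fin N → ℂ}
    (hy : SolvesGram D.pole D.index χ y) {z : ℂ} (hz : z ∉ D.poles) : M z = dressed D χ y z := by
  ext i c
  have hw0 : ∀ j, ∃ w : ℂ, j ∈ D.index → ∀ c, Tendsto
      (fun z => (z - conj (D.pole j)) * (M z i c * s11 D.pole (D.column c) z))
      (𝓝[≠] (conj (D.pole j))) (𝓝 (-(w * conj (χ j c)))) := fun j => by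
    by_cases hj : j ∈ D.index
    · obtain ⟨w, hw⟩ := h.tendsto_conj_pole hD hχ i hj
      exact ⟨w, fun _ => hw⟩
    · exact ⟨0, fun h => absurd h hj⟩
  choose w hw using hw0
  have hform : ∀ c, ∀ z ∉ D.poles, M z i c * s11 D.pole (D.column c) z =
      dressedEntry D.pole D.index χ (fun _ => w) z i c := by
    intro c z hz
    refine eq_const_add_sum_residues D.poleFinset (fun z => M z i c * s11 D.pole (D.column c) z)
      D.index (fun n => conj (D.pole n)) (fun n => -(w n * conj (χ n c))) _
      (fun a _ b _ hab => hD.injective ((starRingEnd ℂ).injective hab))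
      (fun n hn => D.mem_poleFinset.2 ⟨n, hn, Or.inr rfl⟩) ?_ (fun n hn => hw n hn c) ?_ ?_ z
      (fun h => hz (D.mem_poleFinset.1 h))
    · rw [D.coe_poleFinset]
      exact (h.analytic i c).fun_mul fun z hz =>
        (hD.differentiableAt_weight hz c).differentiableWithinAt
    · intro p hp hpn
      obtain ⟨j, hj, rfl | rfl⟩ := D.mem_poleFinset.1 hp
      · obtain ⟨L, hL, -⟩ := h.tendsto_pole hD hχ i hj
        have h1 : Tendsto (fun z => z - D.pole j) (𝓝[≠] (D.pole j)) (𝓝 0) := by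
          have : ContinuousAt (fun z => z - D.pole j) (D.pole j) := by fun_prop
          simpa using this.tendsto.mono_left nhdsWithin_le_nhds
        simpa using h1.mul (hL c)
      · exact absurd rfl (hpn j hj)
    · simpa using (h.limit i c).mul (tendsto_s11_cobounded D.pole (D.column c))
  have hgram : ∀ j ∈ D.index, ∑ n ∈ D.index, gram D.pole χ j n * w n = Complex.I * χ j i := by
    intro j hj
    obtain ⟨L, hL, hL0⟩ := h.tendsto_pole hD hχ i hj
    have h1 : ∀ c, L c = dressedEntry D.pole D.index χ (fun _ => w) (D.pole j) i c := by
      intro c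
      refine tendsto_nhds_unique (hL c) (Tendsto.congr' ?_
        ((differentiableAt_dressedEntry χ (fun _ => w) i c fun n _ =>
          ne_conj_of_im_pos (hD.im_pos j) (hD.im_pos n)).continuousAt.tendsto.mono_left
          nhdsWithin_le_nhds))
      filter_upwards [D.eventually_notMem_poles (D.pole j)] with z hz
      exact (hform c z hz).symm
    rw [h1, h1] at hL0
    exact (kernel_iff_gram D.index χ (fun _ => w) i j (by decide)).1 hL0
  have hwy : ∀ n ∈ D.index, w n = y i n := by
    intro n hn
    rw [← sub_eq_zero]
    refine gram_kernel hD.injective hD.im_pos (fun j hj => (hχ j hj).1)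
      (v := fun n => w n - y i n) (fun j hj => ?_) n hn
    simp_rw [mul_sub, Finset.sum_sub_distrib, hgram j hj, hy i j hj, sub_self]
  have h2 : dressedEntry D.pole D.index χ (fun _ => w) z i c =
      dressedEntry D.pole D.index χ y z i c := by
    unfold dressedEntry
    congr 1
    exact Finset.sum_congr rfl fun n hn => by simp only [hwy n hn]
  simp only [dressed, Matrix.of_apply]
  rw [← h2, ← hform c z hz, mul_div_cancel_right₀ _ (hD.weight_ne_zero hz c)]

theorem isBigO_dressedEntry (k : Fin N → ℂ) (S : Finset (Fin N)) (χ : Fin N → Fin 2 → ℂ)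
    (y : Fin 2 → Fin N → ℂ) (i c : Fin 2) :
    (fun z => dressedEntry k S χ y z i c - (1 : Matrix (Fin 2) (Fin 2) ℂ) i c)
      =O[Bornology.cobounded ℂ] fun z => z⁻¹ := by
  simp only [dressedEntry, add_sub_cancel_left]
  exact Asymptotics.IsBigO.fun_sum fun n _ => isBigO_div_sub _ _

theorem isBigO_dressed (D : SolitonData N) (χ : Fin N → Fin 2 → ℂ)
    (y : Fin 2 → Fin N → ℂ) (i c : Fin 2) :
    (fun z => dressed D χ y z i c - (1 : Matrix (Fin 2) (Fin 2) ℂ) i c)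
      =O[Bornology.cobounded ℂ] fun z => z⁻¹ := by
  simp only [dressed, Matrix.of_apply, div_eq_mul_inv]
  exact isBigO_mul_sub_one (isBigO_dressedEntry _ _ _ _ _ _) (isBigO_inv_s11_sub_one _ _)

theorem tendsto_sub_mul_dressedEntry {k : Fin N → ℂ} (hk : Function.Injective k)
    {S : Finset (Fin N)} (χ : Fin N → Fin 2 → ℂ) (y : Fin 2 → Fin N → ℂ) (i c : Fin 2) {j : Fin N}
    (hj : j ∈ S) : Tendsto (fun z => (z - conj (k j)) * dressedEntry k S χ y z i c)
      (𝓝[≠] (conj (k j))) (𝓝 (-(y i j * conj (χ j c)))) := by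
  have h1 : ContinuousAt (fun z => (z - conj (k j)) * dressedEntry k (S.erase j) χ y z i c -
      (y i j * conj (χ j c))) (conj (k j)) := by
    refine ((continuousAt_id.sub continuousAt_const).mul
      (differentiableAt_dressedEntry χ y i c fun n hn h => ?_).continuousAt).sub continuousAt_const
    exact (Finset.ne_of_mem_erase hn) (hk ((starRingEnd ℂ).injective h)).symm
  have h2 : Tendsto _ _ _ := h1.tendsto.mono_left (nhdsWithin_le_nhds (s := {conj (k j)}ᶜ))
  simp only [sub_self, zero_mul, zero_sub] at h2
  refine h2.congr' ?_
  filter_upwards [self_mem_nhdsWithin] with z hz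
  have : z - conj (k j) ≠ 0 := sub_ne_zero.2 hz
  simp only [dressedEntry, ← Finset.add_sum_erase S _ hj]
  field_simp
  ring

/-- The computations at `k_j` and `conj k_j` read backwards: the Gram equations give the kernel
conditions, and division by the weights turns these into residue relations. -/
theorem dressed_solvesWeakRHP {α x t : ℝ} {D : SolitonData N} (hD : D.Admissible)
    {χ : Fin N → Fin 2 → ℂ} (hχ : Represents α D x t χ) {y : Fin 2 → Fin N → ℂ}
    (hy : SolvesGram D.pole D.index χ y) : SolvesWeakRHP α D x t (dressed D χ y) where
  analytic i c z hz :=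
    ((differentiableAt_dressedEntry χ y i c fun _ hn => D.ne_conj_pole hz hn).fun_div
      (hD.differentiableAt_weight hz c) (hD.weight_ne_zero hz c)).differentiableWithinAt
  limit i c := tendsto_of_isBigO_inv (isBigO_dressed D χ y i c)
  residue j hj := by
    obtain ⟨c, c', hc, hjc, hjc', hΘ, -⟩ := D.exists_column hj α x t
    rw [hΘ, hasResidueRelation_single_iff hc]
    intro i
    have hw : ∀ b, Tendsto (fun z => dressedEntry D.pole D.index χ y z i b) (𝓝[≠] (D.pole j))
        (𝓝 (dressedEntry D.pole D.index χ y (D.pole j) i b)) := fun b =>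
      (differentiableAt_dressedEntry χ y i b fun n _ =>
        ne_conj_of_im_pos (hD.im_pos j) (hD.im_pos n)).continuousAt.tendsto.mono_left
        nhdsWithin_le_nhds
    have hd := s11Deriv_ne_zero hD.injective hD.im_pos (D.column c) j
    have he := s11_pole_ne_zero hD.injective hD.im_pos hjc'
    have h2 := (hw c').div (hD.tendsto_weight j c') he
    refine ⟨dressedEntry D.pole D.index χ y (D.pole j) i c / s11Deriv D.pole (D.column c) j,
      ?_, ?_, ?_⟩
    · refine ((hw c).div (tendsto_s11_div_sub hD.im_pos hjc) hd).congr fun z => ?_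
      simp only [dressed, Matrix.of_apply, Pi.div_apply]
      rw [div_div_eq_mul_div]; ring
    · have h1 : Tendsto (fun z => z - D.pole j) (𝓝[≠] (D.pole j)) (𝓝 0) := by
        have : ContinuousAt (fun z => z - D.pole j) (D.pole j) := by fun_prop
        simpa using this.tendsto.mono_left nhdsWithin_le_nhds
      simpa [dressed] using h1.mul h2
    · have h3 := (kernel_iff_gram D.index χ y i j hc).2 (hy i j hj)
      have h4 := (hχ j hj).2 c c' hc hjc
      have hχc := hχ.apply_ne_zero hD hj hc hjc hjc'
      have : dressedEntry D.pole D.index χ y (D.pole j) i c / s11Deriv D.pole (D.column c) j =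
          dressedEntry D.pole D.index χ y (D.pole j) i c' / s11 D.pole (D.column c') (D.pole j) *
            D.entry α x t j := by
        field_simp
        refine mul_right_cancel₀ hχc ?_
        linear_combination s11 D.pole (D.column c') (D.pole j) * h3 -
          dressedEntry D.pole D.index χ y (D.pole j) i c' * h4
      rw [this]
      exact h2.mul_const _
  residue_conj j hj := by
    obtain ⟨c, c', hc, hjc, hjc', -, hΘ⟩ := D.exists_column hj α x t
    rw [hΘ, hasResidueRelation_single_iff hc.symm]
    intro i
    have hw := fun b => tendsto_sub_mul_dressedEntry hD.injective χ y i b hj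
    have hd : conj (s11Deriv D.pole (D.column c) j) ≠ 0 :=
      (map_ne_zero _).2 (s11Deriv_ne_zero hD.injective hD.im_pos _ _)
    have he : conj (s11 D.pole (D.column c') (D.pole j)) ≠ 0 :=
      (map_ne_zero _).2 (s11_pole_ne_zero hD.injective hD.im_pos hjc')
    have h1 := (hw c').div (hD.tendsto_weight_conj hjc') (inv_ne_zero he)
    have h2 := (hw c).div (tendsto_sub_mul_s11 hD.injective hD.im_pos hjc) (inv_ne_zero hd)
    have h2' : Tendsto (fun z => dressed D χ y z i c) (𝓝[≠] (conj (D.pole j)))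
        (𝓝 (-(y i j * conj (χ j c)) / (conj (s11Deriv D.pole (D.column c) j))⁻¹)) := by
      refine h2.congr' ?_
      filter_upwards [self_mem_nhdsWithin] with z hz
      have : z - conj (D.pole j) ≠ 0 := sub_ne_zero.2 hz
      simp only [dressed, Matrix.of_apply, Pi.div_apply]
      rw [mul_div_mul_left _ _ this]
    refine ⟨_, h1.congr fun z => ?_, ?_, ?_⟩
    · simp only [dressed, Matrix.of_apply, Pi.div_apply]; ring
    · have h3 : Tendsto (fun z => z - conj (D.pole j)) (𝓝[≠] (conj (D.pole j))) (𝓝 0) := by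
        have : ContinuousAt (fun z => z - conj (D.pole j)) (conj (D.pole j)) := by fun_prop
        simpa using this.tendsto.mono_left nhdsWithin_le_nhds
      simpa using h3.mul h2'
    · have h4 := congrArg conj ((hχ j hj).2 c c' hc hjc)
      simp only [map_mul, map_neg] at h4
      have : -(y i j * conj (χ j c')) / (conj (s11 D.pole (D.column c') (D.pole j)))⁻¹ =
          -(y i j * conj (χ j c)) / (conj (s11Deriv D.pole (D.column c) j))⁻¹ *
            -conj (D.entry α x t j) := by
        rw [div_inv_eq_mul, div_inv_eq_mul]
        linear_combination (-y i j) * h4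
      rw [this]
      exact h2'.mul_const _

/-! ### Schwarz reflection, existence and uniqueness. -/

theorem sigma0_conj_apply (X : Matrix (Fin 2) (Fin 2) ℂ) (i c : Fin 2) :
    (sigma0 * X * sigma0⁻¹) i c = (if i = c then 1 else -1) * X i.rev c.rev := by
  have h : sigma0⁻¹ = !![0, -1; 1, 0] := by
    refine Matrix.inv_eq_right_inv ?_
    ext a b
    fin_cases a <;> fin_cases b <;> simp [sigma0, Matrix.mul_apply]
  rw [h]
  fin_cases i <;> fin_cases c <;>
    simp [sigma0, Matrix.mul_apply, Matrix.vecMul, dotProduct, Fin.sum_univ_two]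

/-- Conjugation by `σ₀` swaps the columns `c` and `c'` up to a sign that differs between them; this
sign absorbs the minus in `-conj E`. -/
theorem HasResidueRelation.reflect {M : ℂ → Matrix (Fin 2) (Fin 2) ℂ} {p E : ℂ} {c c' : Fin 2}
    (hc : c ≠ c') (h : HasResidueRelation M (conj p) (Matrix.single c c' (-conj E))) :
    HasResidueRelation (fun z => sigma0 * (M (conj z)).map conj * sigma0⁻¹) p
      (Matrix.single c' c E) := by
  rw [hasResidueRelation_single_iff hc.symm] at h
  rw [hasResidueRelation_single_iff hc]
  intro i
  obtain ⟨R, h1, h2, h3⟩ := h i.rev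
  have hconj : ∀ {f : ℂ → ℂ} {L : ℂ}, Tendsto f (𝓝[≠] (conj p)) (𝓝 L) →
      Tendsto (fun z => conj (f (conj z))) (𝓝[≠] p) (𝓝 (conj L)) := fun hf =>
    (Complex.continuous_conj.tendsto _).comp (hf.comp (tendsto_conj_nhdsNE' p))
  have hr : c.rev = c' ∧ c'.rev = c :=
    (by decide : ∀ a b : Fin 2, a ≠ b → a.rev = b ∧ b.rev = a) c c' hc
  refine ⟨(if i = c then 1 else -1) * conj R, ?_, ?_, ?_⟩
  · refine ((hconj h1).const_mul _).congr fun z => ?_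
    simp only [sigma0_conj_apply, Matrix.map_apply, hr.1, map_mul, map_sub, Complex.conj_conj]
    ring
  · have := (hconj h2).const_mul (if i = c' then 1 else -1)
    simp only [map_zero, mul_zero] at this
    refine this.congr fun z => ?_
    simp only [sigma0_conj_apply, Matrix.map_apply, hr.2, map_mul, map_sub, Complex.conj_conj]
    ring
  · refine ((hconj h3).const_mul _).congr fun z => ?_
    simp only [sigma0_conj_apply, Matrix.map_apply, hr.2, map_mul, map_neg, Complex.conj_conj]
    have : (if i = c' then (1 : ℂ) else -1) = -(if i = c then 1 else -1) := by
      rcases fin_two_eq_or hc i with rfl | rfl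
      · simp [hc]
      · simp [hc.symm]
    rw [this]; ring

theorem SolitonData.conj_mem_poles {D : SolitonData N} {z : ℂ} : conj z ∈ D.poles ↔ z ∈ D.poles := by
  have : ∀ w, w ∈ D.poles → conj w ∈ D.poles := by
    rintro w ⟨j, hj, rfl | rfl⟩
    exacts [⟨j, hj, Or.inr rfl⟩, ⟨j, hj, Or.inl (Complex.conj_conj _)⟩]
  exact ⟨fun h => by simpa using this _ h, this z⟩

theorem tendsto_conj_cobounded :
    Tendsto (fun z : ℂ => conj z) (Bornology.cobounded ℂ) (Bornology.cobounded ℂ) := by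
  rw [← tendsto_norm_atTop_iff_cobounded]
  simpa using tendsto_norm_cobounded_atTop (E := ℂ)

theorem SolvesWeakRHP.reflect {α x t : ℝ} {D : SolitonData N}
    {M : ℂ → Matrix (Fin 2) (Fin 2) ℂ} (h : SolvesWeakRHP α D x t M) :
    SolvesWeakRHP α D x t fun z => sigma0 * (M (conj z)).map conj * sigma0⁻¹ where
  analytic i c z hz := by
    simp only [sigma0_conj_apply, Matrix.map_apply]
    have h1 : DifferentiableAt ℂ (fun z => M z i.rev c.rev) (conj z) :=
      (h.analytic _ _).differentiableAt
        (D.isOpen_compl_poles.mem_nhds fun h => hz (D.conj_mem_poles.1 h))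
    have h2 := h1.conj_conj
    rw [Complex.conj_conj] at h2
    exact ((h2.const_mul _)).differentiableWithinAt
  limit i c := by
    simp only [sigma0_conj_apply, Matrix.map_apply]
    have h1 := (Complex.continuous_conj.tendsto _).comp
      ((h.limit i.rev c.rev).comp tendsto_conj_cobounded)
    have h2 := h1.const_mul (if i = c then 1 else -1)
    have h3 : (1 : Matrix (Fin 2) (Fin 2) ℂ) i c =
        (if i = c then 1 else -1) * conj ((1 : Matrix (Fin 2) (Fin 2) ℂ) i.rev c.rev) := by
      by_cases hic : i = c <;> simp [hic, Matrix.one_apply]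
    rw [h3]
    exact h2
  residue j hj := by
    obtain ⟨c, c', hc, -, -, hΘ, hΘ'⟩ := D.exists_column hj α x t
    have h1 := h.residue_conj j hj
    rw [hΘ'] at h1
    rw [hΘ]
    exact h1.reflect hc
  residue_conj j hj := by
    obtain ⟨c, c', hc, -, -, hΘ, hΘ'⟩ := D.exists_column hj α x t
    have h1 := h.residue j hj
    rw [hΘ']
    refine HasResidueRelation.reflect hc.symm ?_
    rwa [Complex.conj_conj, map_neg, Complex.conj_conj, neg_neg, ← hΘ]

/-- The symmetry is automatic: the reflected matrix solves the same weak problem, whose solution is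
unique. -/
theorem dressed_solvesRHP {α x t : ℝ} {D : SolitonData N} (hD : D.Admissible)
    {χ : Fin N → Fin 2 → ℂ} (hχ : Represents α D x t χ) {y : Fin 2 → Fin N → ℂ}
    (hy : SolvesGram D.pole D.index χ y) : SolvesRHP α D x t (dressed D χ y) where
  analytic := (dressed_solvesWeakRHP hD hχ hy).analytic
  symmetry _ hz := ((dressed_solvesWeakRHP hD hχ hy).reflect.eq_dressed hD hχ hy hz).symm
  asymptotics := isBigO_dressed D χ y
  residue := (dressed_solvesWeakRHP hD hχ hy).residue
  residue_conj := (dressed_solvesWeakRHP hD hχ hy).residue_conj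

theorem exists_solvesGram {k : Fin N → ℂ} (hk : Function.Injective k) (hkim : ∀ j, 0 < (k j).im)
    {χ : Fin N → Fin 2 → ℂ} {S : Finset (Fin N)} (hχ : ∀ j ∈ S, χ j ≠ 0) :
    ∃ y, SolvesGram k S χ y := by
  choose y hy using fun i => gram_solvable hk hkim hχ fun j => Complex.I * χ j i
  exact ⟨y, hy⟩

/-- A kernel vector with first or second entry `1`, according to the column of the pole. -/
theorem SolitonData.Admissible.exists_represents {D : SolitonData N} (hD : D.Admissible)
    (α x t : ℝ) : ∃ χ, Represents α D x t χ := by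
  suffices ∀ j, ∃ v : Fin 2 → ℂ, j ∈ D.index → v ≠ 0 ∧ ∀ c c', c ≠ c' → j ∈ D.column c →
      v c' * s11 D.pole (D.column c') (D.pole j) =
        -(D.entry α x t j * s11Deriv D.pole (D.column c) j * v c) by
    choose χ hχ using this
    exact ⟨χ, hχ⟩
  intro j
  by_cases hj : j ∈ D.index
  · obtain ⟨c, c', hc, hjc, hjc', -⟩ := D.exists_column hj α x t
    have he := s11_pole_ne_zero hD.injective hD.im_pos hjc'
    refine ⟨fun b => if b = c then 1 else
      -(D.entry α x t j * s11Deriv D.pole (D.column c) j) / s11 D.pole (D.column c') (D.pole j),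
      fun _ => ⟨fun h => ?_, fun b b' hb hjb => ?_⟩⟩
    · have := congrFun h c
      simp at this
    · rcases fin_two_eq_or hc b with rfl | rfl
      · have : b' = c' := by omega
        subst this
        simp only [hc.symm, if_true, if_false]
        field_simp
      · exact absurd hjb hjc'
  · exact ⟨0, fun h => absurd h hj⟩

theorem SolitonData.Admissible.exists_solution {D : SolitonData N} (hD : D.Admissible)
    (α x t : ℝ) : ∃ M, SolvesRHP α D x t M := by
  obtain ⟨χ, hχ⟩ := hD.exists_represents α x t
  obtain ⟨y, hy⟩ := exists_solvesGram hD.injective hD.im_pos fun j hj => (hχ j hj).1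
  exact ⟨_, dressed_solvesRHP hD hχ hy⟩

theorem SolitonData.Admissible.unique_solution {D : SolitonData N} (hD : D.Admissible)
    {α x t : ℝ} {M M' : ℂ → Matrix (Fin 2) (Fin 2) ℂ} (h : SolvesRHP α D x t M)
    (h' : SolvesRHP α D x t M') {z : ℂ} (hz : z ∉ D.poles) : M z = M' z := by
  obtain ⟨χ, hχ⟩ := hD.exists_represents α x t
  obtain ⟨y, hy⟩ := exists_solvesGram hD.injective hD.im_pos fun j hj => (hχ j hj).1
  rw [h.weak.eq_dressed hD hχ hy hz, h'.weak.eq_dressed hD hχ hy hz]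

/-! Recovery of the soliton solution -/

/-- The value of `A` in terms of the solution `u` of the linear system with right side `χ · 0`. -/
def valueA (χ : Fin N → Fin 2 → ℂ) (u : Fin N → ℂ) : ℂ := 4 * ∑ n, u n * conj (χ n 1)

/-- The value of `B` in terms of the solutions `u` and `p` of the linear systems with the right
sides `χ · 0` and `χ · 1 / k`. -/
def valueB (α β : ℝ) (k : Fin N → ℂ) (χ : Fin N → Fin 2 → ℂ) (u p : Fin N → ℂ) : ℂ :=
  -(2 * α / β) * ((∑ n, p n * conj (χ n 0)) * ∑ n, u n * (conj (χ n 1) / conj (k n)))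

/-- The evolution in time of the kernel vectors `χ`, starting at time `t`. -/
def evolve (α : ℝ) (k : Fin N → ℂ) (χ : Fin N → Fin 2 → ℂ) (t τ : ℝ) : Fin N → Fin 2 → ℂ :=
  fun j => ![χ j 0, χ j 1 * Complex.exp (-(Complex.I * α / (2 * k j)) * (τ - t))]

@[simp] theorem evolve_zero (α : ℝ) (k : Fin N → ℂ) (χ : Fin N → Fin 2 → ℂ) (t τ : ℝ)
    (j : Fin N) : evolve α k χ t τ j 0 = χ j 0 := rfl

@[simp] theorem evolve_one (α : ℝ) (k : Fin N → ℂ) (χ : Fin N → Fin 2 → ℂ) (t τ : ℝ) (j : Fin N) :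
    evolve α k χ t τ j 1 = χ j 1 * Complex.exp (-(Complex.I * α / (2 * k j)) * (τ - t)) := rfl

theorem evolve_self (α : ℝ) (k : Fin N → ℂ) (χ : Fin N → Fin 2 → ℂ) (t : ℝ) :
    evolve α k χ t t = χ := by
  ext j i
  fin_cases i <;> simp

theorem evolve_ne_zero {α : ℝ} {k : Fin N → ℂ} {χ : Fin N → Fin 2 → ℂ} {t τ : ℝ} {j : Fin N}
    (h : χ j ≠ 0) : evolve α k χ t τ j ≠ 0 := by
  intro h0
  apply h
  have h1 := congrFun h0 0
  have h2 := congrFun h0 1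
  ext i
  fin_cases i
  · simpa using h1
  · simpa [Complex.exp_ne_zero] using h2

theorem ne_zero_of_im_pos {a : ℂ} (h : 0 < a.im) : a ≠ 0 := by
  rintro rfl
  simp at h

/-- Time enters only through the phase, so `exp(2itθ(k_j))` gains the factor `exp(-(iα / (2 k_j)) (τ
- t))`, which is put into the second entry. For `j ∈ ∇` the inverse factor occurs and cancels it. -/
theorem Represents.evolve {α x t : ℝ} {D : SolitonData N} (hD : D.Admissible)
    {χ : Fin N → Fin 2 → ℂ} (h : Represents α D x t χ) (τ : ℝ) :
    Represents α D x τ (evolve α D.pole χ t τ) := by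
  intro j hj
  obtain ⟨h0, h1⟩ := h j hj
  refine ⟨evolve_ne_zero h0, fun c c' hc hjc => ?_⟩
  have h2 := h1 c c' hc hjc
  have hk := ne_zero_of_im_pos (hD.im_pos j)
  have hphase : 2 * Complex.I * tTheta α x τ (D.pole j) = 2 * Complex.I * tTheta α x t (D.pole j) +
      -(Complex.I * α / (2 * D.pole j)) * (τ - t) := by
    simp only [tTheta]
    field_simp
    ring
  rcases (by omega : (c = 0 ∧ c' = 1) ∨ (c = 1 ∧ c' = 0)) with ⟨rfl, rfl⟩ | ⟨rfl, rfl⟩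
  · have hn : j ∉ D.nabla := by simpa [SolitonData.column, hj] using hjc
    simp only [SolitonData.entry, hn, if_false, evolve_zero, evolve_one] at h2 ⊢
    rw [hphase, Complex.exp_add]
    linear_combination Complex.exp (-(Complex.I * α / (2 * D.pole j)) * (τ - t)) * h2
  · have hn : j ∈ D.nabla := by simpa [SolitonData.column] using hjc
    simp only [SolitonData.entry, hn, if_true, evolve_zero, evolve_one] at h2 ⊢
    have hphase' : -2 * Complex.I * tTheta α x τ (D.pole j) =
        -2 * Complex.I * tTheta α x t (D.pole j) -
          -(Complex.I * α / (2 * D.pole j)) * (τ - t) := by linear_combination -hphase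
    rw [hphase', Complex.exp_sub, h2]
    have := Complex.exp_ne_zero (-(Complex.I * α / (2 * D.pole j)) * (τ - t))
    field_simp

theorem tendsto_mul_div_sub_cobounded (R p : ℂ) :
    Tendsto (fun z => z * (R / (z - p))) (Bornology.cobounded ℂ) (𝓝 R) := by
  have h := (tendsto_const_div_sub_cobounded (p * R) p).const_add R
  rw [add_zero] at h
  refine h.congr' ?_
  filter_upwards [Bornology.eventually_ne_cobounded p] with z hz
  have := sub_ne_zero.2 hz
  field_simp
  ring

theorem tendsto_mul_sum_div_weight (k : Fin N → ℂ) (A : Finset (Fin N)) (R : Fin N → ℂ) :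
    Tendsto (fun z => z * ((∑ n, R n / (z - conj (k n))) / s11 k A z)) (Bornology.cobounded ℂ)
      (𝓝 (∑ n, R n)) := by
  have h := (tendsto_finsetSum Finset.univ fun n _ =>
    tendsto_mul_div_sub_cobounded (R n) (conj (k n))).div (tendsto_s11_cobounded k A) one_ne_zero
  rw [div_one] at h
  refine h.congr fun z => ?_
  rw [Pi.div_apply, ← Finset.mul_sum, mul_div_assoc]

theorem exists_solvesGram_extending {k : Fin N → ℂ} (hk : Function.Injective k)
    (hkim : ∀ j, 0 < (k j).im) {χ : Fin N → Fin 2 → ℂ} (hχ : ∀ j, χ j ≠ 0) {u : Fin N → ℂ}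
    (hu : ∀ j, ∑ n, gram k χ j n * u n = χ j 0) :
    ∃ y, SolvesGram k Finset.univ χ y ∧ ∀ n, y 0 n = Complex.I * u n := by
  obtain ⟨v, hv⟩ := gram_solvable hk hkim (S := Finset.univ) (fun j _ => hχ j)
    fun j => Complex.I * χ j 1
  refine ⟨![fun n => Complex.I * u n, v], fun i j _ => ?_, fun n => rfl⟩
  fin_cases i
  · simp only [Fin.zero_eta, Matrix.cons_val_zero, ← hu j, Finset.mul_sum]
    exact Finset.sum_congr rfl fun n _ => by ring
  · exact hv j (Finset.mem_univ _)

theorem gram_det_ne_zero {k : Fin N → ℂ} (hk : Function.Injective k) (hkim : ∀ j, 0 < (k j).im)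
    {χ : Fin N → Fin 2 → ℂ} (hχ : ∀ j, χ j ≠ 0) : (gram k χ).det ≠ 0 := by
  intro h
  obtain ⟨v, hv0, hv⟩ := Matrix.exists_mulVec_eq_zero_iff.2 h
  apply hv0
  ext j
  exact gram_kernel hk hkim (S := Finset.univ) (fun j _ => hχ j) (fun j _ => congrFun hv j) j
    (Finset.mem_univ _)

theorem differentiableAt_det {F : ℝ → Matrix (Fin N) (Fin N) ℂ} {t : ℝ}
    (h : ∀ i j, DifferentiableAt ℝ (fun τ => F τ i j) t) :
    DifferentiableAt ℝ (fun τ => (F τ).det) t := by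
  simp only [Matrix.det_apply]
  exact DifferentiableAt.fun_sum fun σ _ =>
    (DifferentiableAt.fun_finsetProd fun i _ => h (σ i) i).const_smul _

theorem hasDerivAt_evolve_one (α : ℝ) (k : Fin N → ℂ) (χ : Fin N → Fin 2 → ℂ) (t : ℝ) (j : Fin N) :
    HasDerivAt (fun τ => evolve α k χ t τ j 1) (χ j 1 * -(Complex.I * α / (2 * k j))) t := by
  have h1 : HasDerivAt (fun τ : ℝ => -(Complex.I * α / (2 * k j)) * ((τ : ℂ) - t))
      (-(Complex.I * α / (2 * k j)) * 1) t :=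
    ((Complex.ofRealCLM.hasDerivAt (x := t)).sub_const (t : ℂ)).const_mul _
  have h2 := (h1.cexp).const_mul (χ j 1)
  simpa using h2

/-- The product rule yields `1/k_j - 1/conj k_n`, whose numerator cancels the Cauchy denominator; a
rank one matrix is left. -/
theorem hasDerivAt_gram_evolve (α : ℝ) {k : Fin N → ℂ} (hkim : ∀ j, 0 < (k j).im)
    (χ : Fin N → Fin 2 → ℂ) (t : ℝ) (j n : Fin N) :
    HasDerivAt (fun τ => gram k (evolve α k χ t τ) j n)
      (-(α / 2) * (χ j 1 / k j) * (conj (χ n 1) / conj (k n))) t := by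
  have h1 := hasDerivAt_evolve_one α k χ t j
  have h2 := (hasDerivAt_evolve_one α k χ t n).star
  have h3 := ((h1.fun_mul h2).const_add (χ j 0 * conj (χ n 0))).const_mul (cauchyGram k j n)
  refine h3.congr_deriv ?_
  have hj := ne_zero_of_im_pos (hkim j)
  have hn : conj (k n) ≠ 0 := (map_ne_zero _).2 (ne_zero_of_im_pos (hkim n))
  have hjn := sub_conj_ne_zero (hkim j) (hkim n)
  simp only [evolve_self, cauchyGram, Matrix.of_apply, RCLike.star_def, map_mul, map_neg, map_div₀,
    Complex.conj_I, Complex.conj_ofReal, map_ofNat]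
  field_simp
  linear_combination (α * χ j 1 * conj (χ n 1) * (k j - conj (k n))) * Complex.I_sq

/-- The right side of `G U = χ · 0` does not evolve, so `G U' = -G' u`. As `G'` has rank one, this
is a scalar multiple of `χ · 1 / k`, that is, of `G p`. -/
theorem exists_hasDerivAt_solution (α : ℝ) {k : Fin N → ℂ} (hk : Function.Injective k)
    (hkim : ∀ j, 0 < (k j).im) {χ : Fin N → Fin 2 → ℂ} (hχ : ∀ j, χ j ≠ 0) {u p : Fin N → ℂ}
    (hu : ∀ j, ∑ n, gram k χ j n * u n = χ j 0)
    (hp : ∀ j, ∑ n, gram k χ j n * p n = χ j 1 / k j) (t : ℝ) :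
    ∃ U : ℝ → Fin N → ℂ, (∀ τ j, ∑ n, gram k (evolve α k χ t τ) j n * U τ n = χ j 0) ∧
      ∀ n, HasDerivAt (fun τ => U τ n)
        (α / 2 * (∑ m, u m * (conj (χ m 1) / conj (k m))) * p n) t := by
  set G : ℝ → Matrix (Fin N) (Fin N) ℂ := fun τ => gram k (evolve α k χ t τ) with hG
  have hdet : ∀ τ, (G τ).det ≠ 0 := fun τ =>
    gram_det_ne_zero hk hkim fun j => evolve_ne_zero (hχ j)
  have hGd : ∀ j n, DifferentiableAt ℝ (fun τ => G τ j n) t := fun j n =>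
    (hasDerivAt_gram_evolve α hkim χ t j n).differentiableAt
  -- Cramer's rule makes the differentiability of the solution in `τ` evident.
  let U : ℝ → Fin N → ℂ := fun τ n => (G τ).cramer (fun j => χ j 0) n / (G τ).det
  have hU : ∀ τ j, ∑ n, G τ j n * U τ n = χ j 0 := by
    intro τ j
    have h1 := congrFun (Matrix.mulVec_cramer (G τ) fun j => χ j 0) j
    simp only [Matrix.mulVec, dotProduct, Pi.smul_apply, smul_eq_mul] at h1
    simp only [U, ← mul_div_assoc, ← Finset.sum_div]
    rw [h1, mul_div_cancel_left₀ _ (hdet τ)]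
  have hUd : ∀ n, DifferentiableAt ℝ (fun τ => U τ n) t := by
    intro n
    refine DifferentiableAt.fun_div ?_ (differentiableAt_det hGd) (hdet t)
    simp only [Matrix.cramer_apply]
    refine differentiableAt_det fun i j => ?_
    simp only [Matrix.updateCol_apply]
    split_ifs
    · exact differentiableAt_const _
    · exact hGd i j
  have hunique : ∀ v w : Fin N → ℂ, (∀ j, ∑ n, gram k χ j n * v n = ∑ n, gram k χ j n * w n) →
      ∀ n, v n = w n := by
    intro v w hvw n
    rw [← sub_eq_zero]
    refine gram_kernel hk hkim (S := Finset.univ) (fun j _ => hχ j) (v := fun n => v n - w n)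
      (fun j _ => ?_) n (Finset.mem_univ _)
    simp_rw [mul_sub, Finset.sum_sub_distrib, hvw j, sub_self]
  have hGt : G t = gram k χ := by simp only [hG, evolve_self]
  have hUt : ∀ n, U t n = u n := hunique _ _ fun j => by
    rw [hu, ← hGt, hU]
  refine ⟨U, hU, fun n => (hUd n).hasDerivAt.congr_deriv ?_⟩
  refine hunique (fun n => deriv (fun τ => U τ n) t)
    (fun n => α / 2 * (∑ m, u m * (conj (χ m 1) / conj (k m))) * p n) (fun j => ?_) n
  have h1 : HasDerivAt (fun τ => ∑ n, G τ j n * U τ n) _ t :=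
    HasDerivAt.fun_sum fun n _ =>
      (hasDerivAt_gram_evolve α hkim χ t j n).fun_mul (hUd n).hasDerivAt
  have h2 := h1.unique ((hasDerivAt_const t (χ j 0)).congr_of_eventuallyEq
    (Eventually.of_forall fun τ => hU τ j))
  simp only [evolve_self, Finset.sum_add_distrib, hUt] at h2
  have h3 : ∀ S : ℂ, ∑ n, gram k χ j n * (α / 2 * S * p n) = α / 2 * S * (χ j 1 / k j) := by
    intro S
    rw [← hp, Finset.mul_sum]
    exact Finset.sum_congr rfl fun n _ => by ring
  have h4 : ∑ n, -((α : ℂ) / 2) * (χ j 1 / k j) * (conj (χ n 1) / conj (k n)) * u n =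
      -(α / 2 * (∑ m, u m * (conj (χ m 1) / conj (k m))) * (χ j 1 / k j)) := by
    rw [Finset.mul_sum, Finset.sum_mul, ← Finset.sum_neg_distrib]
    exact Finset.sum_congr rfl fun n _ => by ring
  rw [h3]
  rw [h4] at h2
  linear_combination h2

/-- The weights tend to `1` at infinity, so the limits are sums of residues; `y 0 = i u` accounts
for the factors of `i`. In the `B` limit the term `z / s11`, which is unbounded in `z`, is constant
in time and disappears on differentiation. -/
theorem SolvesWeakRHP.recovers {α β x t : ℝ} {D : SolitonData N} (hD : D.Admissible)
    (hindex : D.index = Finset.univ) {M : ℝ → ℝ → ℂ → Matrix (Fin 2) (Fin 2) ℂ}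
    (hM : ∀ y τ, SolvesWeakRHP α D y τ (M y τ)) {χ : Fin N → Fin 2 → ℂ}
    (hχ : Represents α D x t χ) {u p : Fin N → ℂ}
    (hu : ∀ j, ∑ n, gram D.pole χ j n * u n = χ j 0)
    (hp : ∀ j, ∑ n, gram D.pole χ j n * p n = χ j 1 / D.pole j) :
    RecoversA M x t (valueA χ u) ∧ RecoversB β M x t (valueB α β D.pole χ u p) := by
  have hχ0 : ∀ j, χ j ≠ 0 := fun j => (hχ j (hindex ▸ Finset.mem_univ j)).1
  constructor
  · obtain ⟨y, hy, hyu⟩ := exists_solvesGram_extending hD.injective hD.im_pos hχ0 hu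
    have h1 := (tendsto_mul_sum_div_weight D.pole (D.column 1)
      fun n => -(y 0 n * conj (χ n 1))).const_mul (4 * Complex.I)
    have h2 : 4 * Complex.I * ∑ n, -(y 0 n * conj (χ n 1)) = valueA χ u := by
      simp only [valueA, hyu, Finset.mul_sum]
      refine Finset.sum_congr rfl fun n _ => ?_
      linear_combination (-4 * u n * conj (χ n 1)) * Complex.I_mul_I
    rw [h2] at h1
    refine h1.congr' ?_
    filter_upwards [D.eventually_cobounded_notMem_poles] with z hz
    rw [(hM x t).eq_dressed hD hχ (hindex ▸ hy) hz]
    simp [dressed, dressedEntry, hindex]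
  · obtain ⟨U, hU, hUd⟩ := exists_hasDerivAt_solution α hD.injective hD.im_pos hχ0 hu hp t
    set S := ∑ m, u m * (conj (χ m 1) / conj (D.pole m)) with hS
    clear_value S
    have hform : ∀ z ∉ D.poles, ∀ τ, z * M x τ z 0 0 =
        z * ((1 + ∑ n, -(Complex.I * U τ n * conj (χ n 0)) / (z - conj (D.pole n))) /
          s11 D.pole (D.column 0) z) := by
      intro z hz τ
      obtain ⟨y, hy, hyu⟩ := exists_solvesGram_extending hD.injective hD.im_pos
        (fun j => evolve_ne_zero (hχ0 j)) (hU τ)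
      rw [(hM x τ).eq_dressed hD (hχ.evolve hD τ) (hindex ▸ hy) hz]
      simp [dressed, dressedEntry, hindex, hyu]
    have hderiv : ∀ z ∉ D.poles, HasDerivAt (fun τ => z * M x τ z 0 0)
        (z * ((∑ n, -(Complex.I * (α / 2 * S * p n) * conj (χ n 0)) / (z - conj (D.pole n))) /
          s11 D.pole (D.column 0) z)) t := by
      intro z hz
      simp only [hform z hz]
      refine ((HasDerivAt.const_add 1 (HasDerivAt.fun_sum fun n _ => ?_)).div_const _).const_mul z
      exact (((hUd n).const_mul Complex.I).mul_const _).neg.div_const _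
    constructor
    · filter_upwards [D.eventually_cobounded_notMem_poles] with z hz
      exact (hderiv z hz).differentiableAt
    · have h1 := (tendsto_mul_sum_div_weight D.pole (D.column 0)
        fun n => -(Complex.I * (α / 2 * S * p n) * conj (χ n 0))).const_mul (-(4 * Complex.I / β))
      have h2 : -(4 * Complex.I / β) * ∑ n, -(Complex.I * (α / 2 * S * p n) * conj (χ n 0)) =
          valueB α β D.pole χ u p := by
        have h3 : ∑ n, -(Complex.I * (α / 2 * S * p n) * conj (χ n 0)) =
            -(Complex.I * (α / 2) * S) * ∑ n, p n * conj (χ n 0) := by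
          rw [Finset.mul_sum]
          exact Finset.sum_congr rfl fun n _ => by ring
        rw [h3, valueB, ← hS]
        linear_combination (2 * α / β * S * ∑ n, p n * conj (χ n 0)) * Complex.I_mul_I
      rw [h2] at h1
      refine h1.congr' ?_
      filter_upwards [D.eventually_cobounded_notMem_poles] with z hz
      rw [(hderiv z hz).deriv]

/-! Kernel vectors of the modulated data -/

theorem isSolitonValue_of_recovers {α β x t : ℝ} {A B : ℂ} {D : SolitonData N} (hD : D.Admissible)
    (h : ∀ M : ℝ → ℝ → ℂ → Matrix (Fin 2) (Fin 2) ℂ, (∀ y τ, SolvesWeakRHP α D y τ (M y τ)) →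
      RecoversA M x t A ∧ RecoversB β M x t B) : IsSolitonValue α β D x t A B where
  exists_solution := by
    choose M hM using fun y τ => hD.exists_solution α y τ
    exact ⟨M, hM⟩
  unique_solution _ _ _ _ h h' _ hz := hD.unique_solution h h' hz
  recovers M hM := h M fun y τ => (hM y τ).weak

/-- The ratio of the entries of the kernel vector at `k_j` for the norming constant `C`. -/
def kernelRatio (α x t : ℝ) (k : Fin N → ℂ) (C : ℂ) (j : Fin N) : ℂ :=
  -(C * Complex.exp (2 * Complex.I * tTheta α x t (k j)) * s11Deriv k Finset.univ j)

/-- The reason for the independence of `∇`: the derivative of the full Blaschke product at `k_j`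
factors into the contributions of `∇` and of its complement, and the powers of `s11` in the
coefficients compensate exactly for the weights. -/
theorem represents_at_of_ratio {α x t : ℝ} {D : SolitonData N} (hD : D.Admissible)
    (hindex : D.index = Finset.univ) {C : ℂ} (hC : C ≠ 0) {j : Fin N}
    (hcoeff : D.coeff j = if j ∈ D.nabla then C⁻¹ * (s11Deriv D.pole D.nabla j ^ 2)⁻¹
      else C * s11 D.pole D.nabla (D.pole j) ^ 2) {v : Fin 2 → ℂ}
    (hv : v 1 = kernelRatio α x t D.pole C j * v 0) {c c' : Fin 2} (hc : c ≠ c')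
    (hjc : j ∈ D.column c) :
    v c' * s11 D.pole (D.column c') (D.pole j) =
      -(D.entry α x t j * s11Deriv D.pole (D.column c) j * v c) := by
  have hdisj : Disjoint D.nabla (Finset.univ \ D.nabla) := Finset.disjoint_sdiff
  have hunion : D.nabla ∪ (Finset.univ \ D.nabla) = Finset.univ := by simp
  have hcol0 : D.column 0 = Finset.univ \ D.nabla := by simp [SolitonData.column, hindex]
  have hcol1 : D.column 1 = D.nabla := by simp [SolitonData.column]
  rcases (by omega : (c = 0 ∧ c' = 1) ∨ (c = 1 ∧ c' = 0)) with ⟨rfl, rfl⟩ | ⟨rfl, rfl⟩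
  · have hn : j ∉ D.nabla := by simpa [hcol0] using hjc
    have hσ : s11Deriv D.pole Finset.univ j =
        s11Deriv D.pole (Finset.univ \ D.nabla) j * s11 D.pole D.nabla (D.pole j) := by
      rw [← s11Deriv_union hdisj.symm (by simpa using hn), Finset.union_comm, hunion]
    simp only [SolitonData.entry, hcoeff, hn, if_false, hv, kernelRatio, hσ, hcol0, hcol1]
    ring
  · have hn : j ∈ D.nabla := by simpa [hcol1] using hjc
    have hσ : s11Deriv D.pole Finset.univ j =
        s11Deriv D.pole D.nabla j * s11 D.pole (Finset.univ \ D.nabla) (D.pole j) := by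
      rw [← s11Deriv_union hdisj hn, hunion]
    have hd := s11Deriv_ne_zero hD.injective hD.im_pos D.nabla j
    have hexp : Complex.exp (-2 * Complex.I * tTheta α x t (D.pole j)) =
        (Complex.exp (2 * Complex.I * tTheta α x t (D.pole j)))⁻¹ := by
      rw [← Complex.exp_neg]; congr 1; ring
    have := Complex.exp_ne_zero (2 * Complex.I * tTheta α x t (D.pole j))
    simp only [SolitonData.entry, hcoeff, hn, if_true, hv, kernelRatio, hσ, hcol0, hcol1, hexp]
    field_simp

theorem modulatedData_coeff {k : Fin N → ℂ} (hkim : ∀ j, 0 < (k j).im) (c d : Fin N → ℂ)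
    (S nabla : Finset (Fin N)) (j : Fin N) : (modulatedData k c d S nabla).coeff j =
      if j ∈ nabla then (c j * (d j ^ 2)⁻¹)⁻¹ * (s11Deriv k nabla j ^ 2)⁻¹
      else c j * (d j ^ 2)⁻¹ * s11 k nabla (k j) ^ 2 := by
  simp only [modulatedData]
  split_ifs with h
  · rw [(hasDerivAt_s11 hkim h).deriv, mul_inv, inv_inv]; ring
  · ring

theorem fullData_isSolitonValue {α β : ℝ} {r : ℝ → ℂ} {k c : Fin N → ℂ}
    (hk : Function.Injective k) (hkim : ∀ j, 0 < (k j).im) (hc : ∀ j, c j ≠ 0) {κ x t : ℝ}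
    (nabla : Finset (Fin N)) {χ : Fin N → Fin 2 → ℂ} (hχ0 : ∀ j, χ j ≠ 0)
    (hχ : ∀ j, χ j 1 = kernelRatio α x t k (c j * (delta α r κ (k j) ^ 2)⁻¹) j * χ j 0)
    {u p : Fin N → ℂ} (hu : ∀ j, ∑ n, gram k χ j n * u n = χ j 0)
    (hp : ∀ j, ∑ n, gram k χ j n * p n = χ j 1 / k j) :
    IsSolitonValue α β (fullData α r k c κ nabla) x t (valueA χ u) (valueB α β k χ u p) := by
  have hD : (fullData α r k c κ nabla).Admissible := ⟨hk, hkim, Finset.subset_univ _⟩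
  refine isSolitonValue_of_recovers hD fun M hM => ?_
  refine SolvesWeakRHP.recovers hD rfl hM (fun j _ => ⟨hχ0 j, fun a b hab hja => ?_⟩) hu hp
  exact represents_at_of_ratio hD rfl
    (mul_ne_zero (hc j) (inv_ne_zero (pow_ne_zero 2 (Complex.exp_ne_zero _))))
    (modulatedData_coeff hkim _ _ _ _ j) (hχ j) hab hja

/-- Data on all eigenvalues, trivial outside `S`, with the poles in `F` in the second column. -/
def SolitonData.extend (D : SolitonData N) (F : Finset (Fin N)) : SolitonData N where
  index := Finset.univ
  pole := D.pole
  coeff j := if j ∈ D.index then D.coeff j else 0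
  nabla := F ∪ D.nabla

theorem hasResidueRelation_zero {M : ℂ → Matrix (Fin 2) (Fin 2) ℂ} {p : ℂ}
    (h : ∀ a b, ContinuousAt (fun z => M z a b) p) : HasResidueRelation M p 0 := by
  refine ⟨0, tendsto_pi_nhds.2 fun a => tendsto_pi_nhds.2 fun b => ?_, by simp⟩
  have h1 : ContinuousAt (fun z => (z - p) * M z a b) p :=
    (continuousAt_id.sub continuousAt_const).mul (h a b)
  simpa using h1.tendsto.mono_left (nhdsWithin_le_nhds (s := {p}ᶜ))

theorem SolitonData.residueMatrix_eq_zero {D : SolitonData N} {α x t : ℝ} {j : Fin N}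
    (h : D.coeff j = 0) : D.residueMatrix α x t j = 0 := by
  unfold residueMatrix
  rw [h]
  split_ifs <;> ext a b <;> fin_cases a <;> fin_cases b <;> simp

theorem SolitonData.residueMatrixConj_eq_zero {D : SolitonData N} {α x t : ℝ} {j : Fin N}
    (h : D.coeff j = 0) : D.residueMatrixConj α x t j = 0 := by
  unfold residueMatrixConj
  rw [h]
  split_ifs <;> ext a b <;> fin_cases a <;> fin_cases b <;> simp

/-- `M` is analytic at the added points, so it satisfies residue relations with zero matrix there.
Each added point may be assigned to either column, and `F` records the choice. -/
theorem SolvesWeakRHP.extend {α x t : ℝ} {D : SolitonData N} (hD : D.Admissible)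
    {M : ℂ → Matrix (Fin 2) (Fin 2) ℂ} (h : SolvesWeakRHP α D x t M) {F : Finset (Fin N)}
    (hF : Disjoint F D.index) : SolvesWeakRHP α (D.extend F) x t M := by
  have hcont : ∀ p ∉ D.poles, ∀ a b, ContinuousAt (fun z => M z a b) p := fun p hp a b =>
    ((h.analytic a b).differentiableAt (D.isOpen_compl_poles.mem_nhds hp)).continuousAt
  have hmem : ∀ j ∈ D.index, (j ∈ F ∪ D.nabla ↔ j ∈ D.nabla) := fun j hj => by
    simp [Finset.disjoint_right.1 hF hj]
  have hout : ∀ j ∉ D.index, D.pole j ∉ D.poles := by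
    rintro j hj ⟨n, hn, hjn | hjn⟩
    · exact hj (hD.injective hjn ▸ hn)
    · exact ne_conj_of_im_pos (hD.im_pos j) (hD.im_pos n) hjn
  refine ⟨fun a b => (h.analytic a b).mono ?_, h.limit, fun j _ => ?_, fun j _ => ?_⟩
  · refine Set.compl_subset_compl.2 ?_
    rintro z ⟨j, hj, hz⟩
    exact ⟨j, Finset.mem_univ _, hz⟩
  · by_cases hj : j ∈ D.index
    · have : (D.extend F).residueMatrix α x t j = D.residueMatrix α x t j := by
        simp only [SolitonData.residueMatrix, SolitonData.extend, hj, if_true, hmem j hj]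
      rw [this]
      exact h.residue j hj
    · have : (D.extend F).residueMatrix α x t j = 0 :=
        SolitonData.residueMatrix_eq_zero (if_neg hj)
      rw [this]
      exact hasResidueRelation_zero (hcont _ (hout j hj))
  · by_cases hj : j ∈ D.index
    · have : (D.extend F).residueMatrixConj α x t j = D.residueMatrixConj α x t j := by
        simp only [SolitonData.residueMatrixConj, SolitonData.extend, hj, if_true, hmem j hj]
      rw [this]
      exact h.residue_conj j hj
    · have : (D.extend F).residueMatrixConj α x t j = 0 :=
        SolitonData.residueMatrixConj_eq_zero (if_neg hj)
      rw [this]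
      exact hasResidueRelation_zero (hcont _ fun h => hout j hj (D.conj_mem_poles.1 h))

/-- With the fast outside eigenvalues as `F`, the modified constant is `c_j s11_F(k_j)^2`. It
supplies the factors that turn powers of `s11` over `∇ ∩ 𝓘` into those over `F ∪ (∇ ∩ 𝓘)`, so the
kernel ratios inside `𝓘` agree with those of the full problem. -/
theorem insideData_isSolitonValue {α β v₁ v₂ : ℝ} {r : ℝ → ℂ} {k c : Fin N → ℂ}
    (hk : Function.Injective k) (hkim : ∀ j, 0 < (k j).im) (hc : ∀ j, c j ≠ 0) {κ x t : ℝ}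
    (nabla : Finset (Fin N)) {χ : Fin N → Fin 2 → ℂ} (hχ0 : ∀ j, χ j ≠ 0)
    (hχ : ∀ j ∈ inside α v₁ v₂ k,
      χ j 1 = kernelRatio α x t k (c j * (delta α r κ (k j) ^ 2)⁻¹) j * χ j 0)
    (hfast : ∀ j ∉ inside α v₁ v₂ k, j ∈ fastSet α k κ → χ j 0 = 0)
    (hslow : ∀ j ∉ inside α v₁ v₂ k, j ∉ fastSet α k κ → χ j 1 = 0)
    {u p : Fin N → ℂ} (hu : ∀ j, ∑ n, gram k χ j n * u n = χ j 0)
    (hp : ∀ j, ∑ n, gram k χ j n * p n = χ j 1 / k j) :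
    IsSolitonValue α β (insideData α v₁ v₂ r k c κ nabla) x t (valueA χ u)
      (valueB α β k χ u p) := by
  have hD : (insideData α v₁ v₂ r k c κ nabla).Admissible :=
    ⟨hk, hkim, Finset.inter_subset_right⟩
  set I := inside α v₁ v₂ k with hI
  set F := fastSet α k κ \ I with hF
  set D := insideData α v₁ v₂ r k c κ nabla with hDdef
  have hFI : Disjoint F I := Finset.sdiff_disjoint
  have hD0 : (D.extend F).Admissible := ⟨hk, hkim, Finset.subset_univ _⟩
  refine isSolitonValue_of_recovers hD fun M hM => ?_
  refine SolvesWeakRHP.recovers hD0 rfl (fun y τ => (hM y τ).extend hD hFI)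
    (fun j _ => ⟨hχ0 j, fun a b hab hja => ?_⟩) hu hp
  by_cases hj : j ∈ I
  · refine represents_at_of_ratio hD0 rfl (C := c j * (delta α r κ (k j) ^ 2)⁻¹)
      (mul_ne_zero (hc j) (inv_ne_zero (pow_ne_zero 2 (Complex.exp_ne_zero _)))) ?_ (hχ j hj)
      hab hja
    have hjF : j ∉ F := Finset.disjoint_right.1 hFI hj
    have hdisj : Disjoint (nabla ∩ I) F := hFI.symm.mono_left Finset.inter_subset_right
    have hconst : insideConst α v₁ v₂ k c κ j = c j * s11 k F (k j) ^ 2 := by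
      simp only [insideConst, s11, Finset.prod_pow]
      rfl
    have hcoeff : (D.extend F).coeff j = D.coeff j := if_pos hj
    have hcoeff' : D.coeff j = _ := modulatedData_coeff hkim (insideConst α v₁ v₂ k c κ)
      (fun j => delta α r κ (k j)) I (nabla ∩ I) j
    rw [hconst] at hcoeff'
    rw [hcoeff, hcoeff']
    change _ = if j ∈ F ∪ nabla ∩ I then _ * (s11Deriv k (F ∪ nabla ∩ I) j ^ 2)⁻¹
      else _ * s11 k (F ∪ nabla ∩ I) (k j) ^ 2
    have hiff : j ∈ F ∪ nabla ∩ I ↔ j ∈ nabla ∩ I := by simp [hjF]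
    simp only [hiff]
    split_ifs with hjn
    · rw [Finset.union_comm, s11Deriv_union hdisj hjn]
      simp only [mul_inv, mul_pow, inv_inv]
      ring
    · rw [Finset.union_comm, s11_union hdisj]
      ring
  -- With a zero entry the defining relation holds once the component of `χ_j` in the other column
  -- vanishes: the second for slow solitons, the first for fast ones.
  · have hentry : (D.extend F).entry α x t j = 0 := by
      have : (D.extend F).coeff j = 0 := if_neg hj
      rw [SolitonData.entry, this, zero_mul]
    have hb : χ j b = 0 := by
      rcases (by omega : (a = 0 ∧ b = 1) ∨ (a = 1 ∧ b = 0)) with ⟨rfl, rfl⟩ | ⟨rfl, rfl⟩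
      · refine hslow j hj fun h => ?_
        have h1 : j ∉ F ∪ nabla ∩ I := by
          have : j ∈ Finset.univ \ (F ∪ nabla ∩ I) := hja
          simpa using this
        exact h1 (Finset.mem_union_left _ (Finset.mem_sdiff.2 ⟨h, hj⟩))
      · refine hfast j hj ?_
        have h1 : j ∈ F ∪ nabla ∩ I := hja
        rcases Finset.mem_union.1 h1 with h2 | h2
        · exact (Finset.mem_sdiff.1 h2).1
        · exact absurd (Finset.mem_inter.1 h2).2 hj
    rw [hentry, hb]; simp

/-! Stability of the soliton solution under perturbation of the kernel vectors -/

/-- Coercivity gives `l ‖v‖² ≤ ‖v‖ ∑ |(G v)_i|` in the sup norm; divide by `‖v‖`. -/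
theorem exists_gram_bound {k : Fin N → ℂ} (hk : Function.Injective k) (hkim : ∀ j, 0 < (k j).im) :
    ∃ K : ℝ, ∀ (χ : Fin N → Fin 2 → ℂ), (∀ j, 1 ≤ ‖χ j 0‖ ^ 2 + ‖χ j 1‖ ^ 2) →
      ∀ (v : Fin N → ℂ) (j : Fin N), ‖v j‖ ≤ K * ∑ i, ‖∑ n, gram k χ i n * v n‖ := by
  obtain ⟨l, hl, h⟩ := gram_coercive hk hkim
  refine ⟨l⁻¹, fun χ hχ v j => ?_⟩
  set w : Fin N → ℂ := fun i => ∑ n, gram k χ i n * v n with hw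
  set W := ∑ i, ‖w i‖ with hW
  have hW0 : 0 ≤ W := Finset.sum_nonneg fun i _ => norm_nonneg _
  have h1 : (∑ j, ∑ n, conj (v j) * gram k χ j n * v n).re ≤ ‖v‖ * W := by
    refine (Complex.re_le_norm _).trans ((norm_sum_le _ _).trans ?_)
    rw [hW, Finset.mul_sum]
    refine Finset.sum_le_sum fun i _ => ?_
    have : ∑ n, conj (v i) * gram k χ i n * v n = conj (v i) * w i := by
      rw [hw, Finset.mul_sum]
      exact Finset.sum_congr rfl fun n _ => by ring
    rw [this, norm_mul, RCLike.norm_conj]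
    exact mul_le_mul_of_nonneg_right (norm_le_pi_norm v i) (norm_nonneg _)
  have h2 : ∀ i, l * ‖v i‖ ^ 2 ≤ ‖v‖ * W := by
    intro i
    refine le_trans (mul_le_mul_of_nonneg_left ?_ hl.le) ((h χ v).trans h1)
    refine le_trans ?_ (Finset.single_le_sum
      (f := fun j => (‖χ j 0‖ ^ 2 + ‖χ j 1‖ ^ 2) * ‖v j‖ ^ 2)
      (fun j _ => by positivity) (Finset.mem_univ i))
    exact le_mul_of_one_le_left (sq_nonneg _) (hχ i)
  have h3 : ‖v‖ ≤ √(l⁻¹ * (‖v‖ * W)) := by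
    refine (pi_norm_le_iff_of_nonneg (Real.sqrt_nonneg _)).2 fun i => Real.le_sqrt_of_sq_le ?_
    rw [inv_mul_eq_div, le_div_iff₀ hl, mul_comm]
    exact h2 i
  have h4 : ‖v‖ ^ 2 ≤ l⁻¹ * (‖v‖ * W) := by
    refine (pow_le_pow_left₀ (norm_nonneg _) h3 2).trans_eq (Real.sq_sqrt ?_)
    have := norm_nonneg v
    positivity
  refine (norm_le_pi_norm v j).trans ?_
  rcases (norm_nonneg v).eq_or_lt with h0 | h0
  · rw [← h0]; positivity
  · refine le_of_mul_le_mul_left ?_ h0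
    linarith

/-! ### Lipschitz estimates for families of kernel vectors. -/

variable {ι : Type*} {l : Filter ι} {ε : ι → ℝ}

theorem isBigO_mul_sub_mul {f f₀ g g₀ : ι → ℂ} (hf : (fun p => f p - f₀ p) =O[l] ε)
    (hg : (fun p => g p - g₀ p) =O[l] ε) (hg1 : g =O[l] fun _ => (1 : ℝ))
    (hf1 : f₀ =O[l] fun _ => (1 : ℝ)) : (fun p => f p * g p - f₀ p * g₀ p) =O[l] ε := by
  have h1 := hf.mul hg1
  have h2 := hf1.mul hg
  simp only [mul_one, one_mul] at h1 h2
  refine (h1.add h2).congr_left fun p => ?_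
  ring

theorem isBigO_conj_iff {f : ι → ℂ} {g : ι → ℝ} : (fun p => conj (f p)) =O[l] g ↔ f =O[l] g := by
  rw [← Asymptotics.isBigO_norm_left]
  simp only [RCLike.norm_conj, Asymptotics.isBigO_norm_left]

/-- A family of normalized bounded kernel vectors. -/
structure BoundedKernels (l : Filter ι) (χ : ι → Fin N → Fin 2 → ℂ) : Prop where
  bounded : ∀ j i, (fun p => χ p j i) =O[l] fun _ => (1 : ℝ)
  one_le : ∀ p j, 1 ≤ ‖χ p j 0‖ ^ 2 + ‖χ p j 1‖ ^ 2

theorem BoundedKernels.isBigO_gram_sub {χ χ₀ : ι → Fin N → Fin 2 → ℂ} (h : BoundedKernels l χ)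
    (h₀ : BoundedKernels l χ₀) (hd : ∀ j i, (fun p => χ p j i - χ₀ p j i) =O[l] ε)
    (k : Fin N → ℂ) (j n : Fin N) :
    (fun p => gram k (χ p) j n - gram k (χ₀ p) j n) =O[l] ε := by
  have h1 := fun i => isBigO_mul_sub_mul (hd j i) (g := fun p => conj (χ p n i))
    (g₀ := fun p => conj (χ₀ p n i))
    (by simpa only [← map_sub] using isBigO_conj_iff.2 (hd n i))
    (isBigO_conj_iff.2 (h.bounded n i)) (h₀.bounded j i)
  refine (((h1 0).add (h1 1)).const_mul_left (cauchyGram k j n)).congr_left fun p => ?_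
  simp only [gram, Matrix.of_apply]
  ring

theorem BoundedKernels.isBigO_of_gram {χ : ι → Fin N → Fin 2 → ℂ} (h : BoundedKernels l χ)
    {k : Fin N → ℂ} (hk : Function.Injective k) (hkim : ∀ j, 0 < (k j).im) {v : ι → Fin N → ℂ}
    {g : ι → ℝ} (hv : ∀ j, (fun p => ∑ n, gram k (χ p) j n * v p n) =O[l] g) (j : Fin N) :
    (fun p => v p j) =O[l] g := by
  obtain ⟨K, hK⟩ := exists_gram_bound hk hkim
  refine Asymptotics.IsBigO.trans (g := fun p => ∑ i, ‖∑ n, gram k (χ p) i n * v p n‖) ?_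
    (Asymptotics.IsBigO.fun_sum fun i _ => (hv i).norm_left)
  refine Asymptotics.IsBigO.of_bound K (Eventually.of_forall fun p => ?_)
  rw [Real.norm_of_nonneg (Finset.sum_nonneg fun i _ => norm_nonneg _)]
  exact hK (χ p) (h.one_le p) (v p) j

/-- Resolvent identity `G (u - u₀) = (q - q₀) - (G - G₀) u₀`, followed by the uniform bound on the
inverse of `G`. -/
theorem BoundedKernels.isBigO_solution_sub {χ χ₀ : ι → Fin N → Fin 2 → ℂ}
    (h : BoundedKernels l χ) (h₀ : BoundedKernels l χ₀)
    (hd : ∀ j i, (fun p => χ p j i - χ₀ p j i) =O[l] ε) {k : Fin N → ℂ}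
    (hk : Function.Injective k) (hkim : ∀ j, 0 < (k j).im) {q q₀ u u₀ : ι → Fin N → ℂ}
    (hq : ∀ j, (fun p => q p j - q₀ p j) =O[l] ε)
    (hu : ∀ p j, ∑ n, gram k (χ p) j n * u p n = q p j)
    (hu₀ : ∀ p j, ∑ n, gram k (χ₀ p) j n * u₀ p n = q₀ p j)
    (hu1 : ∀ j, (fun p => u₀ p j) =O[l] fun _ => (1 : ℝ)) (j : Fin N) :
    (fun p => u p j - u₀ p j) =O[l] ε := by
  refine h.isBigO_of_gram hk hkim (v := fun p n => u p n - u₀ p n) (fun j => ?_) j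
  have h1 : (fun p => ∑ n, (gram k (χ p) j n - gram k (χ₀ p) j n) * u₀ p n) =O[l] ε := by
    refine Asymptotics.IsBigO.fun_sum fun n _ => ?_
    have := (h.isBigO_gram_sub h₀ hd k j n).mul (hu1 n)
    simpa only [mul_one] using this
  refine ((hq j).sub h1).congr_left fun p => ?_
  simp only [sub_mul, mul_sub, Finset.sum_sub_distrib, hu, hu₀]
  ring

/-- `A` and `B` are polynomial in bounded quantities and their conjugates, each of which changes by
`O(ε)`. Smallness of `ε` is not needed. -/
theorem isBigO_value_sub {χ χ₀ : ι → Fin N → Fin 2 → ℂ}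
    (h : BoundedKernels l χ) (h₀ : BoundedKernels l χ₀)
    (hd : ∀ j i, (fun p => χ p j i - χ₀ p j i) =O[l] ε) {k : Fin N → ℂ}
    (hk : Function.Injective k) (hkim : ∀ j, 0 < (k j).im) (α β : ℝ)
    {u u₀ w w₀ : ι → Fin N → ℂ}
    (hu : ∀ p j, ∑ n, gram k (χ p) j n * u p n = χ p j 0)
    (hu₀ : ∀ p j, ∑ n, gram k (χ₀ p) j n * u₀ p n = χ₀ p j 0)
    (hw : ∀ p j, ∑ n, gram k (χ p) j n * w p n = χ p j 1 / k j)
    (hw₀ : ∀ p j, ∑ n, gram k (χ₀ p) j n * w₀ p n = χ₀ p j 1 / k j) :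
    (fun p => valueA (χ p) (u p) - valueA (χ₀ p) (u₀ p)) =O[l] ε ∧
      (fun p => valueB α β k (χ p) (u p) (w p) - valueB α β k (χ₀ p) (u₀ p) (w₀ p)) =O[l] ε := by
  have hdiv : ∀ {f : ι → ℂ} {g : ι → ℝ} (z : ℂ), f =O[l] g → (fun p => f p / z) =O[l] g :=
    fun z hf => by simpa only [div_eq_inv_mul] using hf.const_mul_left z⁻¹
  have hu1 : ∀ j, (fun p => u p j) =O[l] fun _ => (1 : ℝ) :=
    h.isBigO_of_gram hk hkim fun j => by simpa only [hu] using h.bounded j 0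
  have hu₀1 : ∀ j, (fun p => u₀ p j) =O[l] fun _ => (1 : ℝ) :=
    h₀.isBigO_of_gram hk hkim fun j => by simpa only [hu₀] using h₀.bounded j 0
  have hw1 : ∀ j, (fun p => w p j) =O[l] fun _ => (1 : ℝ) :=
    h.isBigO_of_gram hk hkim fun j => by simpa only [hw] using hdiv (k j) (h.bounded j 1)
  have hw₀1 : ∀ j, (fun p => w₀ p j) =O[l] fun _ => (1 : ℝ) :=
    h₀.isBigO_of_gram hk hkim fun j => by simpa only [hw₀] using hdiv (k j) (h₀.bounded j 1)
  have hud := h.isBigO_solution_sub h₀ hd hk hkim (fun j => hd j 0) hu hu₀ hu₀1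
  have hwd := h.isBigO_solution_sub h₀ hd hk hkim
    (fun j => by simpa only [← sub_div] using hdiv (k j) (hd j 1)) hw hw₀ hw₀1
  have hc := fun j i => isBigO_conj_iff.2 (h.bounded j i)
  have hcd : ∀ j i, (fun p => conj (χ p j i) - conj (χ₀ p j i)) =O[l] ε := fun j i => by
    simpa only [← map_sub] using isBigO_conj_iff.2 (hd j i)
  have hbound : ∀ {f g : ι → Fin N → ℂ}, (∀ j, (fun p => f p j) =O[l] fun _ => (1 : ℝ)) →
      (∀ j, (fun p => g p j) =O[l] fun _ => (1 : ℝ)) →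
      (fun p => ∑ j, f p j * g p j) =O[l] fun _ => (1 : ℝ) := fun hf hg =>
    Asymptotics.IsBigO.fun_sum fun j _ => by simpa only [mul_one] using (hf j).mul (hg j)
  have hsub : ∀ {f f₀ g g₀ : ι → Fin N → ℂ}, (∀ j, (fun p => f p j - f₀ p j) =O[l] ε) →
      (∀ j, (fun p => g p j - g₀ p j) =O[l] ε) →
      (∀ j, (fun p => g p j) =O[l] fun _ => (1 : ℝ)) →
      (∀ j, (fun p => f₀ p j) =O[l] fun _ => (1 : ℝ)) →
      (fun p => ∑ j, f p j * g p j - ∑ j, f₀ p j * g₀ p j) =O[l] ε := fun hf hg hg1 hf1 => by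
    simp only [← Finset.sum_sub_distrib]
    exact Asymptotics.IsBigO.fun_sum fun j _ =>
      isBigO_mul_sub_mul (hf j) (hg j) (hg1 j) (hf1 j)
  constructor
  · refine ((hsub (g := fun p n => conj (χ p n 1)) (g₀ := fun p n => conj (χ₀ p n 1))
      hud (fun j => hcd j 1) (fun j => hc j 1) hu₀1).const_mul_left 4).congr_left fun p => ?_
    simp only [valueA, mul_sub]
  · have hP := hsub (g := fun p n => conj (χ p n 0)) (g₀ := fun p n => conj (χ₀ p n 0))
      hwd (fun j => hcd j 0) (fun j => hc j 0) hw₀1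
    have hS := hsub (g := fun p n => conj (χ p n 1) / conj (k n))
      (g₀ := fun p n => conj (χ₀ p n 1) / conj (k n))
      hud (fun j => by simpa only [← sub_div] using hdiv _ (hcd j 1)) (fun j => hdiv _ (hc j 1))
      hu₀1
    have hS1 := hbound (g := fun p n => conj (χ p n 1) / conj (k n)) hu1 fun j => hdiv _ (hc j 1)
    have hP1 := hbound (g := fun p n => conj (χ₀ p n 0)) hw₀1 fun j =>
      isBigO_conj_iff.2 (h₀.bounded j 0)
    refine ((isBigO_mul_sub_mul hP hS hS1 hP1).const_mul_left (-(2 * α / β : ℂ))).congr_left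
      fun p => ?_
    simp only [valueB, mul_sub]

/-! Estimates in the cone -/

theorem integrable_nu {r : ℝ → ℂ} (hr : MemLp r 2 volume) : Integrable (nu r) := by
  have h1 : Integrable (fun s => ‖r s‖ ^ 2) := by simpa using hr.integrable_norm_pow (by norm_num)
  have h2 : Integrable (fun s => Real.log (1 + ‖r s‖ ^ 2)) := by
    refine h1.mono' ?_ (Eventually.of_forall fun s => ?_)
    · exact (Real.measurable_log.comp_aemeasurable
        (h1.aestronglyMeasurable.aemeasurable.const_add 1)).aestronglyMeasurable
    · have h3 : 0 ≤ ‖r s‖ ^ 2 := by positivity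
      rw [Real.norm_of_nonneg (Real.log_nonneg (by linarith))]
      linarith [Real.log_le_sub_one_of_pos (show 0 < 1 + ‖r s‖ ^ 2 by linarith)]
  exact h2.const_mul _

/-- Since `|s - z| ≥ Im z` and `ν` is integrable, the exponent is bounded whatever the jump set;
uniformity in `κ` matters because `k₀` moves with `(x, t)`. -/
theorem exists_delta_bound (α : ℝ) {r : ℝ → ℂ} (hr : MemLp r 2 volume) {z : ℂ} (hz : 0 < z.im) :
    ∃ K : ℝ, 0 < K ∧ ∀ κ, ‖delta α r κ z‖ ≤ K ∧ ‖delta α r κ z‖⁻¹ ≤ K := by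
  have hν := integrable_nu hr
  have hg : Integrable (fun s => z.im⁻¹ * ‖nu r s‖) := hν.norm.const_mul _
  refine ⟨Real.exp (∫ s, z.im⁻¹ * ‖nu r s‖), Real.exp_pos _, fun κ => ?_⟩
  set J := ∫ s in jumpSet α κ, (nu r s : ℂ) / ((s : ℂ) - z) with hJ
  have hJle : ‖J‖ ≤ ∫ s, z.im⁻¹ * ‖nu r s‖ := by
    refine (norm_integral_le_of_norm_le hg.integrableOn
      (Eventually.of_forall fun s => ?_)).trans
      (setIntegral_le_integral hg (Eventually.of_forall fun s => by positivity))
    have h1 : z.im ≤ ‖(s : ℂ) - z‖ := by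
      have := Complex.abs_im_le_norm ((s : ℂ) - z)
      simp only [Complex.sub_im, Complex.ofReal_im, zero_sub, abs_neg] at this
      exact (le_abs_self _).trans this
    rw [norm_div, Complex.norm_real, div_eq_inv_mul]
    exact mul_le_mul_of_nonneg_right (inv_anti₀ hz h1) (norm_nonneg _)
  have hre : |(Complex.I * J).re| ≤ ‖J‖ := by
    simpa using Complex.abs_re_le_norm (Complex.I * J)
  have h2 := abs_le.1 hre
  rw [delta, ← hJ, Complex.norm_exp, ← Real.exp_neg, Real.exp_le_exp, Real.exp_le_exp]
  constructor <;> linarith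

theorem norm_exp_tTheta (α x t : ℝ) (z : ℂ) : ‖Complex.exp (2 * Complex.I * tTheta α x t z)‖ =
    Real.exp (-2 * z.im * (x - velocity α z * t)) := by
  have him : (tTheta α x t z).im = z.im * (x - velocity α z * t) := by
    have h1 : tTheta α x t z = z * x - ((α * t / 4 : ℝ) : ℂ) * z⁻¹ := by
      simp only [tTheta]
      push_cast
      rw [div_eq_mul_inv, mul_inv, div_eq_mul_inv]
      ring
    rw [h1, Complex.sub_im, Complex.im_mul_ofReal, Complex.im_ofReal_mul, Complex.inv_im,
      Complex.normSq_eq_norm_sq, velocity]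
    rcases eq_or_ne ‖z‖ 0 with h | h
    · rw [h]; simp
    · field_simp
  rw [Complex.norm_exp]
  congr 1
  have : (2 * Complex.I * tTheta α x t z).re = -2 * (tTheta α x t z).im := by simp
  rw [this, him]; ring

theorem exists_kernelRatio_bound (α : ℝ) {r : ℝ → ℂ} (hr : MemLp r 2 volume) {k c : Fin N → ℂ}
    (hk : Function.Injective k) (hkim : ∀ j, 0 < (k j).im) (hc : ∀ j, c j ≠ 0) (j : Fin N) :
    ∃ K : ℝ, 0 < K ∧ ∀ κ x t,
      ‖kernelRatio α x t k (c j * (delta α r κ (k j) ^ 2)⁻¹) j‖ ≤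
        K * Real.exp (-2 * (k j).im * (x - velocity α (k j) * t)) ∧
      ‖(kernelRatio α x t k (c j * (delta α r κ (k j) ^ 2)⁻¹) j)⁻¹‖ ≤
        K * Real.exp (2 * (k j).im * (x - velocity α (k j) * t)) := by
  obtain ⟨L, hL, hδ⟩ := exists_delta_bound α hr (hkim j)
  have hc' := norm_pos_iff.2 (hc j)
  have hσ := norm_pos_iff.2 (s11Deriv_ne_zero hk hkim Finset.univ j)
  set a := ‖c j‖ with ha
  set b := ‖s11Deriv k Finset.univ j‖ with hb
  refine ⟨(a * b + (a * b)⁻¹) * L ^ 2, by positivity, fun κ x t => ?_⟩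
  obtain ⟨h1, h2⟩ := hδ κ
  have h1' : ‖delta α r κ (k j)‖ ^ 2 ≤ L ^ 2 := pow_le_pow_left₀ (norm_nonneg _) h1 2
  have h2' : (‖delta α r κ (k j)‖ ^ 2)⁻¹ ≤ L ^ 2 := by
    rw [← inv_pow]
    exact pow_le_pow_left₀ (by positivity) h2 2
  have hnorm : ‖kernelRatio α x t k (c j * (delta α r κ (k j) ^ 2)⁻¹) j‖ =
      a * b * (‖delta α r κ (k j)‖ ^ 2)⁻¹ *
        Real.exp (-2 * (k j).im * (x - velocity α (k j) * t)) := by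
    rw [kernelRatio, norm_neg, norm_mul, norm_mul, norm_mul, norm_exp_tTheta, norm_inv, norm_pow]
    ring
  have hab : 0 < a * b := by positivity
  have hab' : 0 < (a * b)⁻¹ := by positivity
  constructor
  · rw [hnorm]
    gcongr
    linarith
  · rw [norm_inv, hnorm, mul_inv, mul_inv _ (_ ⁻¹), inv_inv, ← Real.exp_neg]
    have : -(-2 * (k j).im * (x - velocity α (k j) * t)) =
        2 * (k j).im * (x - velocity α (k j) * t) := by ring
    rw [this]
    gcongr
    linarith

/-- Compare `|k_j|²` with `k₀² = -αt / (4x)`. For `α > 0` one has `x < 0`, which reverses the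
inequality and explains the switch from `Δ⁻` to `Δ⁺`. -/
theorem mem_fastSet_iff {α x t : ℝ} (hα : α ≠ 0) (ht : 0 < t) (hpos : 0 < -(α * t) / (4 * x))
    {k : Fin N → ℂ} {j : Fin N} (hj : 0 < (k j).im) :
    j ∈ fastSet α k (k0 α x t) ↔ x < velocity α (k j) * t := by
  have hn : 0 < ‖k j‖ := norm_pos_iff.2 (ne_zero_of_im_pos hj)
  have hx : x ≠ 0 := by
    rintro rfl
    simp at hpos
  have hv : velocity α (k j) * t = -(α * t) / (4 * ‖k j‖ ^ 2) := by
    rw [velocity]; ring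
  rw [hv, lt_div_iff₀ (by positivity)]
  rcases lt_or_gt_of_ne hα with h | h
  · have hαt : 0 < -(α * t) := by nlinarith
    have hx0 : 0 < 4 * x := (div_pos_iff_of_pos_left hαt).1 hpos
    simp only [fastSet, h, if_true, deltaMinus, Finset.mem_filter_univ]
    rw [k0, Real.lt_sqrt hn.le, lt_div_iff₀ hx0]
    constructor <;> intro h <;> linarith
  · have hαt : -(α * t) < 0 := by nlinarith
    have hx0 : 4 * x < 0 := by
      by_contra hx1
      push Not at hx1
      exact absurd hpos (not_lt.2 (div_nonpos_of_nonpos_of_nonneg hαt.le hx1))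
    simp only [fastSet, not_lt.2 h.le, if_false, deltaPlus, Finset.mem_filter_univ]
    rw [k0, Real.sqrt_lt' hn, div_lt_iff_of_neg hx0]
    constructor <;> intro h <;> linarith

/-- All velocities have the sign opposite to `α`. `T` is the time at which the velocity closest to
zero outweighs the initial position. -/
theorem exists_time_pos {α x₁ x₂ v₁ v₂ : ℝ} (hv₁ : α * v₁ < 0) (hv₂ : α * v₂ < 0) :
    ∃ T : ℝ, 0 < T ∧ ∀ x t : ℝ, (x, t) ∈ cone x₁ x₂ v₁ v₂ → T ≤ t → 0 < -(α * t) / (4 * x) := by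
  rcases lt_trichotomy α 0 with h | h | h
  · have hv : 0 < v₁ := by nlinarith
    have hT : 0 < (|x₁| + 1) / v₁ := by positivity
    refine ⟨(|x₁| + 1) / v₁, hT, fun x t hxt ht => ?_⟩
    obtain ⟨x₀, hx₀, v, hv', hx⟩ := hxt
    simp only at hx
    have ht0 : 0 < t := hT.trans_le ht
    rw [div_le_iff₀ hv] at ht
    have h1 : v₁ * t ≤ v * t := mul_le_mul_of_nonneg_right hv'.1 ht0.le
    have hx0 : 0 < x := by
      have := neg_abs_le x₁
      have := hx₀.1
      linarith
    have : 0 < -(α * t) := by nlinarith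
    positivity
  · simp [h] at hv₁
  · have hv : v₂ < 0 := by nlinarith
    have hv0 : 0 < -v₂ := neg_pos.2 hv
    have hT : 0 < (|x₂| + 1) / (-v₂) := by positivity
    refine ⟨(|x₂| + 1) / (-v₂), hT, fun x t hxt ht => ?_⟩
    obtain ⟨x₀, hx₀, v, hv', hx⟩ := hxt
    simp only at hx
    have ht0 : 0 < t := hT.trans_le ht
    rw [div_le_iff₀ hv0] at ht
    have h1 : v * t ≤ v₂ * t := mul_le_mul_of_nonneg_right hv'.2 ht0.le
    have hx0 : x < 0 := by
      have := le_abs_self x₂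
      have := hx₀.2
      linarith
    have : 0 < α * t := by positivity
    exact div_pos_of_neg_of_neg (by linarith) (by linarith)

theorem infDist_mul_sub_le {x₁ x₂ v₁ v₂ x t w : ℝ} (hxt : (x, t) ∈ cone x₁ x₂ v₁ v₂) (ht : 0 ≤ t) :
    Metric.infDist w (Set.Icc v₁ v₂) * t - (|x₁| + |x₂|) ≤ |x - w * t| := by
  obtain ⟨x₀, hx₀, v, hv, hx⟩ := hxt
  simp only at hx
  have h1 := Metric.infDist_le_dist_of_mem (x := w) hv
  rw [dist_comm, Real.dist_eq] at h1
  have h2 : |x₀| ≤ |x₁| + |x₂| := by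
    have := neg_abs_le x₁
    have := le_abs_self x₂
    have := abs_nonneg x₁
    have := abs_nonneg x₂
    exact abs_le.2 ⟨by linarith [hx₀.1], by linarith [hx₀.2]⟩
  have h3 : |v - w| * t = |(x - w * t) - x₀| := by
    rw [← abs_of_nonneg ht, ← abs_mul, abs_of_nonneg ht, hx]
    congr 1; ring
  have h4 := abs_sub (x - w * t) x₀
  have h5 := mul_le_mul_of_nonneg_right h1 ht
  linarith

/-- The bound for the soliton with eigenvalue `z` on either side of its trajectory. -/
theorem exp_le_of_rate {x₁ x₂ v₁ v₂ x t w μ h : ℝ} (hxt : (x, t) ∈ cone x₁ x₂ v₁ v₂) (ht : 0 ≤ t)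
    (hh : 0 ≤ h) (hμ : μ ≤ h * Metric.infDist w (Set.Icc v₁ v₂)) :
    Real.exp (-2 * h * |x - w * t|) ≤
      Real.exp (2 * h * (|x₁| + |x₂|)) * Real.exp (-2 * μ * t) := by
  rw [← Real.exp_add, Real.exp_le_exp]
  have h1 := mul_le_mul_of_nonneg_left (infDist_mul_sub_le (w := w) hxt ht) hh
  have h2 := mul_le_mul_of_nonneg_right hμ ht
  nlinarith

/-- A kernel vector with ratio `e` of the entries, normalized by the first entry if `P`, and by the
second entry otherwise. -/
def normalizedKernel (P : Prop) [Decidable P] (e : ℂ) : Fin 2 → ℂ :=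
  if P then ![1, e] else ![e⁻¹, 1]

section normalizedKernel

variable (P : Prop) [Decidable P] (e : ℂ)

theorem one_le_normalizedKernel :
    1 ≤ ‖normalizedKernel P e 0‖ ^ 2 + ‖normalizedKernel P e 1‖ ^ 2 := by
  unfold normalizedKernel
  split_ifs <;> simp

theorem normalizedKernel_ratio {e : ℂ} (he : e ≠ 0) :
    normalizedKernel P e 1 = e * normalizedKernel P e 0 := by
  unfold normalizedKernel
  split_ifs <;> simp [he]

theorem norm_normalizedKernel_le {K : ℝ} (hK : 1 ≤ K) (h : P → ‖e‖ ≤ K) (h' : ¬P → ‖e⁻¹‖ ≤ K)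
    (i : Fin 2) : ‖normalizedKernel P e i‖ ≤ K := by
  unfold normalizedKernel
  split_ifs with hP <;> fin_cases i
  · simpa using hK
  · simpa using h hP
  · simpa using h' hP
  · simpa using hK

theorem norm_normalizedKernel_sub_le {K : ℝ} (hK : 0 ≤ K) (h : P → ‖e‖ ≤ K)
    (h' : ¬P → ‖e⁻¹‖ ≤ K) (i : Fin 2) :
    ‖normalizedKernel P e i - normalizedKernel P 0 i‖ ≤ K := by
  unfold normalizedKernel
  split_ifs with hP <;> fin_cases i
  · simpa using hK
  · simpa using h hP
  · simpa using h' hP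
  · simpa using hK

end normalizedKernel

theorem ne_zero_of_one_le {v : Fin 2 → ℂ} (h : 1 ≤ ‖v 0‖ ^ 2 + ‖v 1‖ ^ 2) : v ≠ 0 := by
  rintro rfl
  norm_num at h

theorem kernelRatio_ne_zero {α x t : ℝ} {k : Fin N → ℂ} (hk : Function.Injective k)
    (hkim : ∀ j, 0 < (k j).im) {C : ℂ} (hC : C ≠ 0) (j : Fin N) :
    kernelRatio α x t k C j ≠ 0 :=
  neg_ne_zero.2 (mul_ne_zero (mul_ne_zero hC (Complex.exp_ne_zero _))
    (s11Deriv_ne_zero hk hkim _ _))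

open Classical in
/-- The normalized kernel vectors of the full problem at the point `p`. -/
def fullKernels (α v₁ v₂ : ℝ) (r : ℝ → ℂ) (k c : Fin N → ℂ) (p : ℝ × ℝ) (j : Fin N) : Fin 2 → ℂ :=
  let e := kernelRatio α p.1 p.2 k (c j * (delta α r (k0 α p.1 p.2) (k j) ^ 2)⁻¹) j
  if j ∈ inside α v₁ v₂ k then normalizedKernel (‖e‖ ≤ 1) e
  else normalizedKernel (j ∉ fastSet α k (k0 α p.1 p.2)) e

open Classical in
/-- The normalized kernel vectors at the point `p` when the eigenvalues outside `𝓘` are trivial. -/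
def insideKernels (α v₁ v₂ : ℝ) (r : ℝ → ℂ) (k c : Fin N → ℂ) (p : ℝ × ℝ) (j : Fin N) :
    Fin 2 → ℂ :=
  if j ∈ inside α v₁ v₂ k then fullKernels α v₁ v₂ r k c p j
  else normalizedKernel (j ∉ fastSet α k (k0 α p.1 p.2)) 0

/-! ### Decay of the kernel vectors outside the annulus. -/

section estimates

variable {α v₁ v₂ : ℝ} {r : ℝ → ℂ} {k c : Fin N → ℂ}

theorem one_le_fullKernels (p : ℝ × ℝ) (j : Fin N) :
    1 ≤ ‖fullKernels α v₁ v₂ r k c p j 0‖ ^ 2 + ‖fullKernels α v₁ v₂ r k c p j 1‖ ^ 2 := by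
  simp only [fullKernels]
  split_ifs
  · exact one_le_normalizedKernel _ _
  · exact one_le_normalizedKernel _ _

theorem one_le_insideKernels (p : ℝ × ℝ) (j : Fin N) :
    1 ≤ ‖insideKernels α v₁ v₂ r k c p j 0‖ ^ 2 + ‖insideKernels α v₁ v₂ r k c p j 1‖ ^ 2 := by
  simp only [insideKernels]
  split_ifs
  · exact one_le_fullKernels p j
  · exact one_le_normalizedKernel _ _

theorem fullKernels_ratio (hk : Function.Injective k) (hkim : ∀ j, 0 < (k j).im)
    (hc : ∀ j, c j ≠ 0) (p : ℝ × ℝ) (j : Fin N) : fullKernels α v₁ v₂ r k c p j 1 =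
      kernelRatio α p.1 p.2 k (c j * (delta α r (k0 α p.1 p.2) (k j) ^ 2)⁻¹) j *
        fullKernels α v₁ v₂ r k c p j 0 := by
  have he := kernelRatio_ne_zero (α := α) (x := p.1) (t := p.2) hk hkim
    (C := c j * (delta α r (k0 α p.1 p.2) (k j) ^ 2)⁻¹)
    (mul_ne_zero (hc j) (inv_ne_zero (pow_ne_zero 2 (Complex.exp_ne_zero _)))) j
  simp only [fullKernels]
  split_ifs
  · exact normalizedKernel_ratio _ he
  · exact normalizedKernel_ratio _ he

theorem insideKernels_fast {p : ℝ × ℝ} {j : Fin N} (hj : j ∉ inside α v₁ v₂ k)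
    (hf : j ∈ fastSet α k (k0 α p.1 p.2)) : insideKernels α v₁ v₂ r k c p j 0 = 0 := by
  simp [insideKernels, hj, hf, normalizedKernel]

theorem insideKernels_slow {p : ℝ × ℝ} {j : Fin N} (hj : j ∉ inside α v₁ v₂ k)
    (hf : j ∉ fastSet α k (k0 α p.1 p.2)) : insideKernels α v₁ v₂ r k c p j 1 = 0 := by
  simp [insideKernels, hj, hf, normalizedKernel]

variable {x₁ x₂ μ : ℝ} {s : Set (ℝ × ℝ)}

/-- The ratio is of size `exp(-2 Im k_j (x - v_{k_j} t))`. It is itself small when `x` is ahead of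
the soliton, and its inverse is small when `x` is behind. -/
theorem exists_outside_bound (hα : α ≠ 0) (hr : MemLp r 2 volume) (hk : Function.Injective k)
    (hkim : ∀ j, 0 < (k j).im) (hc : ∀ j, c j ≠ 0)
    (hs : ∀ p ∈ s, p ∈ cone x₁ x₂ v₁ v₂ ∧ 0 < p.2 ∧ 0 < -(α * p.2) / (4 * p.1)) (j : Fin N) :
    ∃ K : ℝ, 1 ≤ K ∧ ∀ p ∈ s,
      let e := kernelRatio α p.1 p.2 k (c j * (delta α r (k0 α p.1 p.2) (k j) ^ 2)⁻¹) j
      let b := K * Real.exp (-2 * (k j).im * |p.1 - velocity α (k j) * p.2|)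
      (j ∉ fastSet α k (k0 α p.1 p.2) → ‖e‖ ≤ b) ∧
      (¬j ∉ fastSet α k (k0 α p.1 p.2) → ‖e⁻¹‖ ≤ b) := by
  obtain ⟨K, hK, h⟩ := exists_kernelRatio_bound α hr hk hkim hc j
  refine ⟨max 1 K, le_max_left _ _, fun p hp => ?_⟩
  obtain ⟨-, ht, hpos⟩ := hs p hp
  obtain ⟨h1, h2⟩ := h (k0 α p.1 p.2) p.1 p.2
  have hfast := mem_fastSet_iff hα ht hpos (k := k) (hkim j)
  refine ⟨fun hf => ?_, fun hf => ?_⟩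
  · rw [hfast, not_lt, ← sub_nonneg] at hf
    rw [abs_of_nonneg hf]
    exact h1.trans (mul_le_mul_of_nonneg_right (le_max_right _ _) (Real.exp_pos _).le)
  · rw [not_not, hfast, ← sub_neg] at hf
    rw [abs_of_neg hf]
    have : -2 * (k j).im * -(p.1 - velocity α (k j) * p.2) =
        2 * (k j).im * (p.1 - velocity α (k j) * p.2) := by ring
    rw [this]
    exact h2.trans (mul_le_mul_of_nonneg_right (le_max_right _ _) (Real.exp_pos _).le)

/-- Inside `𝓘` no decay is available, and normalizing by the larger entry gives the bound. Outside,
the normalization follows the sign of `x - v_{k_j} t`. -/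
theorem boundedKernels_fullKernels (hα : α ≠ 0) (hr : MemLp r 2 volume)
    (hk : Function.Injective k) (hkim : ∀ j, 0 < (k j).im) (hc : ∀ j, c j ≠ 0)
    (hs : ∀ p ∈ s, p ∈ cone x₁ x₂ v₁ v₂ ∧ 0 < p.2 ∧ 0 < -(α * p.2) / (4 * p.1)) :
    BoundedKernels (𝓟 s) (fullKernels α v₁ v₂ r k c) where
  one_le := one_le_fullKernels
  bounded j i := by
    obtain ⟨K, hK, h⟩ := exists_outside_bound hα hr hk hkim hc hs j
    refine Asymptotics.isBigO_principal.2 ⟨K, fun p hp => ?_⟩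
    obtain ⟨h1, h2⟩ := h p hp
    rw [norm_one, mul_one]
    have hexp : K * Real.exp (-2 * (k j).im * |p.1 - velocity α (k j) * p.2|) ≤ K := by
      refine mul_le_of_le_one_right (by linarith) (Real.exp_le_one_iff.2 ?_)
      have := mul_nonneg (hkim j).le (abs_nonneg (p.1 - velocity α (k j) * p.2))
      linarith
    simp only [fullKernels]
    split_ifs
    · refine norm_normalizedKernel_le _ _ hK (fun h => h.trans hK) (fun h => ?_) i
      rw [norm_inv]
      exact (inv_le_one_of_one_le₀ (not_le.1 h).le).trans hK
    · exact norm_normalizedKernel_le _ _ hK (fun h => (h1 h).trans hexp)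
        (fun h => (h2 h).trans hexp) i

theorem boundedKernels_insideKernels (hα : α ≠ 0) (hr : MemLp r 2 volume)
    (hk : Function.Injective k) (hkim : ∀ j, 0 < (k j).im) (hc : ∀ j, c j ≠ 0)
    (hs : ∀ p ∈ s, p ∈ cone x₁ x₂ v₁ v₂ ∧ 0 < p.2 ∧ 0 < -(α * p.2) / (4 * p.1)) :
    BoundedKernels (𝓟 s) (insideKernels α v₁ v₂ r k c) where
  one_le := one_le_insideKernels
  bounded j i := by
    simp only [insideKernels]
    split_ifs with hj
    · exact (boundedKernels_fullKernels hα hr hk hkim hc hs).bounded j i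
    · refine Asymptotics.isBigO_principal.2 ⟨1, fun p _ => ?_⟩
      rw [norm_one, mul_one]
      exact norm_normalizedKernel_le _ _ le_rfl (by simp) (by simp) i

/-- Inside `𝓘` the vectors coincide, so `μ` is constrained by the outside eigenvalues only and may
be arbitrary when there are none. -/
theorem isBigO_fullKernels_sub (hα : α ≠ 0) (hr : MemLp r 2 volume)
    (hk : Function.Injective k) (hkim : ∀ j, 0 < (k j).im) (hc : ∀ j, c j ≠ 0)
    (hs : ∀ p ∈ s, p ∈ cone x₁ x₂ v₁ v₂ ∧ 0 < p.2 ∧ 0 < -(α * p.2) / (4 * p.1))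
    (hμ : ∀ j ∉ inside α v₁ v₂ k,
      μ ≤ (k j).im * Metric.infDist (velocity α (k j)) (Set.Icc v₁ v₂)) (j : Fin N) (i : Fin 2) :
    (fun p => fullKernels α v₁ v₂ r k c p j i - insideKernels α v₁ v₂ r k c p j i)
      =O[𝓟 s] fun p => Real.exp (-2 * μ * p.2) := by
  by_cases hj : j ∈ inside α v₁ v₂ k
  · simp only [insideKernels, hj, if_true, sub_self]
    exact Asymptotics.isBigO_zero _ _
  · obtain ⟨K, hK, h⟩ := exists_outside_bound hα hr hk hkim hc hs j
    refine Asymptotics.isBigO_principal.2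
      ⟨K * Real.exp (2 * (k j).im * (|x₁| + |x₂|)), fun p hp => ?_⟩
    obtain ⟨h1, h2⟩ := h p hp
    obtain ⟨hcone, ht, -⟩ := hs p hp
    have h3 := mul_le_mul_of_nonneg_left (exp_le_of_rate hcone ht.le (hkim j).le (hμ j hj))
      (zero_le_one.trans hK)
    rw [← mul_assoc] at h3
    rw [Real.norm_of_nonneg (Real.exp_pos _).le]
    simp only [insideKernels, fullKernels, hj, if_false]
    exact norm_normalizedKernel_sub_le _ _ (by positivity) (fun h => (h1 h).trans h3)
      (fun h => (h2 h).trans h3) i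

end estimates

end ABSystem

end

theorem mainTheorem4 {N : ℕ} (α β : ℝ) (hα : α ≠ 0) (hβ : β ≠ 0)
    (k c : Fin N → ℂ) (hk : Function.Injective k) (hkim : ∀ j, 0 < (k j).im)
    (hc : ∀ j, c j ≠ 0) (r : ℝ → ℂ) (hr : MemLp r 2 volume)
    (x₁ x₂ v₁ v₂ : ℝ) (hx : x₁ < x₂) (hv : v₁ < v₂) (hv₁ : α * v₁ < 0) (hv₂ : α * v₂ < 0)
    (μ : ℝ) (hμ : (ABSystem.rateSet α v₁ v₂ k).Nonempty →
      IsLeast (ABSystem.rateSet α v₁ v₂ k) μ) :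
    ∃ C T : ℝ, 0 < T ∧ ∀ x t : ℝ, (x, t) ∈ ABSystem.cone x₁ x₂ v₁ v₂ → T ≤ t →
      0 < -(α * t) / (4 * x) ∧
      ∃ A B A' B' : ℂ,
        (∀ nabla : Finset (Fin N),
          nabla = ABSystem.deltaMinus k (ABSystem.k0 α x t) ∨
            nabla = ABSystem.deltaPlus k (ABSystem.k0 α x t) →
          ABSystem.IsSolitonValue α β
              (ABSystem.fullData α r k c (ABSystem.k0 α x t) nabla) x t A B ∧
            ABSystem.IsSolitonValue α β
              (ABSystem.insideData α v₁ v₂ r k c (ABSystem.k0 α x t) nabla) x t A' B') ∧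
        ‖A - A'‖ ≤ C * Real.exp (-2 * μ * t) ∧
        ‖B - B'‖ ≤ C * Real.exp (-2 * μ * t) := by
  obtain ⟨T, hT, hpos⟩ := ABSystem.exists_time_pos (x₁ := x₁) (x₂ := x₂) hv₁ hv₂
  let s : Set (ℝ × ℝ) := {p | p ∈ ABSystem.cone x₁ x₂ v₁ v₂ ∧ T ≤ p.2}
  have hs : ∀ p ∈ s, p ∈ ABSystem.cone x₁ x₂ v₁ v₂ ∧ 0 < p.2 ∧ 0 < -(α * p.2) / (4 * p.1) :=
    fun p hp => ⟨hp.1, hT.trans_le hp.2, hpos p.1 p.2 hp.1 hp.2⟩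
  have hμ' : ∀ j ∉ ABSystem.inside α v₁ v₂ k,
      μ ≤ (k j).im * Metric.infDist (ABSystem.velocity α (k j)) (Set.Icc v₁ v₂) := by
    intro j hj
    have hmem : (k j).im * Metric.infDist (ABSystem.velocity α (k j)) (Set.Icc v₁ v₂) ∈
        ABSystem.rateSet α v₁ v₂ k := ⟨j, by simpa [ABSystem.inside] using hj, rfl⟩
    exact (hμ ⟨_, hmem⟩).2 hmem
  set χ := ABSystem.fullKernels α v₁ v₂ r k c with hχ
  set χ₀ := ABSystem.insideKernels α v₁ v₂ r k c with hχ₀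
  have hne : ∀ p j, χ p j ≠ 0 := fun p j =>
    ABSystem.ne_zero_of_one_le (ABSystem.one_le_fullKernels p j)
  have hne₀ : ∀ p j, χ₀ p j ≠ 0 := fun p j =>
    ABSystem.ne_zero_of_one_le (ABSystem.one_le_insideKernels p j)
  -- The Gram systems are solvable at every `p`, so the families are defined on the whole plane; the
  -- cone matters only for the estimates.
  choose u hu using fun p => ABSystem.gram_solvable hk hkim (S := Finset.univ)
    (fun j _ => hne p j) fun j => χ p j 0
  choose w hw using fun p => ABSystem.gram_solvable hk hkim (S := Finset.univ)
    (fun j _ => hne p j) fun j => χ p j 1 / k j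
  choose u₀ hu₀ using fun p => ABSystem.gram_solvable hk hkim (S := Finset.univ)
    (fun j _ => hne₀ p j) fun j => χ₀ p j 0
  choose w₀ hw₀ using fun p => ABSystem.gram_solvable hk hkim (S := Finset.univ)
    (fun j _ => hne₀ p j) fun j => χ₀ p j 1 / k j
  obtain ⟨hA, hB⟩ := ABSystem.isBigO_value_sub
    (ABSystem.boundedKernels_fullKernels hα hr hk hkim hc hs)
    (ABSystem.boundedKernels_insideKernels hα hr hk hkim hc hs)
    (ABSystem.isBigO_fullKernels_sub hα hr hk hkim hc hs hμ') hk hkim α β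
    (fun p j => hu p j (Finset.mem_univ j)) (fun p j => hu₀ p j (Finset.mem_univ j))
    (fun p j => hw p j (Finset.mem_univ j)) (fun p j => hw₀ p j (Finset.mem_univ j))
  -- For the principal filter of `s`, a big-O is a bound with one constant on all of `s`.
  obtain ⟨C₁, hC₁⟩ := Asymptotics.isBigO_principal.1 hA
  obtain ⟨C₂, hC₂⟩ := Asymptotics.isBigO_principal.1 hB
  -- The four values are built from `χ` and `χ₀`, in which `∇` does not occur, so they serve every
  -- `∇`.
  refine ⟨max C₁ C₂, T, hT, fun x t hxt ht => ⟨hpos x t hxt ht, _, _, _, _,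
    fun nabla _ => ⟨ABSystem.fullData_isSolitonValue hk hkim hc nabla (hne (x, t))
      (ABSystem.fullKernels_ratio hk hkim hc (x, t))
      (fun j => hu (x, t) j (Finset.mem_univ j)) (fun j => hw (x, t) j (Finset.mem_univ j)),
      ABSystem.insideData_isSolitonValue hk hkim hc nabla (hne₀ (x, t)) (fun j hj => ?_)
      (fun j hj hf => ABSystem.insideKernels_fast hj hf)
      (fun j hj hf => ABSystem.insideKernels_slow hj hf)
      (fun j => hu₀ (x, t) j (Finset.mem_univ j)) fun j => hw₀ (x, t) j (Finset.mem_univ j)⟩,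
    ?_, ?_⟩⟩
  · simp only [hχ₀, ABSystem.insideKernels, hj, if_true]
    exact ABSystem.fullKernels_ratio hk hkim hc (x, t) j
  · have h := hC₁ (x, t) ⟨hxt, ht⟩
    rw [Real.norm_of_nonneg (Real.exp_pos _).le] at h
    exact h.trans (mul_le_mul_of_nonneg_right (le_max_left _ _) (Real.exp_pos _).le)
  · have h := hC₂ (x, t) ⟨hxt, ht⟩
    rw [Real.norm_of_nonneg (Real.exp_pos _).le] at h
    exact h.trans (mul_le_mul_of_nonneg_right (le_max_right _ _) (Real.exp_pos _).le)
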